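/- Let $R$ be a commutative noetherian local ring with maximal ideal $\mathfrak m$ and residue field $k=R/\mathfrak m$, let $\widehat R$ be its $\mathfrak m$-adic completion, let $E=E_R(k)$ be an injective hull of $k$, and write $L^\vee=\operatorname{Hom}_R(L,E)$ for an $R$-module $L$. For a commutative ring $S$, an ideal $\mathfrak a\subseteq S$ and an $S$-module $L$ put $$\operatorname{depth}_S(\mathfrak a;L)=\inf\{i\ge 0\mid \operatorname{Ext}^i_S(S/\mathfrak a,L)\ne 0\},$$ where $\inf\emptyset=\infty$. An artinian $R$-module $A$ is $\mathfrak m$-torsion (each element is killed by a power of $\mathfrak m$), and hence is an $\widehat R$-module as follows: if $x\in A$, $\mathfrak m^n x=0$, $r\in\widehat R$, and $r_0\in R$ has the same image as $r$ in $R/\mathfrak m^n$, then $rx=r_0x$. This makes $A^\vee$ an $\widehat R$-module via $(rf)(x)=f(rx)$. Theorem. Let $A$ and $A'$ be artinian $R$-modules, and let $N$ and $N'$ be noetherian $R$-modules. Then the following equalities hold in $\{0,1,2,\dots\}\cup\{\infty\}$: \begin{align*} \operatorname{depth}_{\widehat R}(\operatorname{Ann}_{\widehat R}(A');A^\vee)&=\inf\{i\ge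 0\mid \operatorname{Ext}^i_R(A,A')\ne 0\},\\ \operatorname{depth}_{R}(\operatorname{Ann}_{R}(N');A^\vee)&=\inf\{i\ge 0\mid \operatorname{Ext}^i_R(A,N'^\vee)\ne 0\},\\ \operatorname{depth}_{R}(\operatorname{Ann}_{R}(N');N)&=\inf\{i\ge 0\mid \operatorname{Ext}^i_R(N^\vee,N'^\vee)\ne 0\}. \end{align*} -/

import Mathlib

universe u

/-! ## Injective hulls -/

/-- The `R`-linear map `ι : M → E` exhibits `E` as an injective hull of `M`:
`ι` is injective, `E` is an injective `R`-module, and `E` is an essential extension of the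
image of `ι`. -/
structure IsInjectiveHull {R : Type u} [CommRing R] {M E : Type u} [AddCommGroup M] [Module R M]
    [AddCommGroup E] [Module R E] (ι : M →ₗ[R] E) : Prop where
  injective_map : Function.Injective ι
  injective_module : Module.Injective R E
  essential : ∀ N : Submodule R E, N ⊓ LinearMap.range ι = ⊥ → N = ⊥

/-- Every module has an injective hull. -/
theorem exists_isInjectiveHull (R : Type u) [CommRing R] (M : Type u) [AddCommGroup M]
    [Module R M] : ∃ (E : Type u) (_ : AddCommGroup E) (_ : Module R E) (ι : M →ₗ[R] E),
      IsInjectiveHull ι := by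
  classical
  obtain ⟨P⟩ := CategoryTheory.EnoughInjectives.presentation (ModuleCat.of R M)
  have hI : Module.Injective R P.J :=
    (Module.injective_iff_injective_object R P.J).mpr P.injective
  let j : M →ₗ[R] P.J := P.f.hom
  have hj : Function.Injective j := (ModuleCat.mono_iff_injective P.f).mp P.mono
  let S : Set (Submodule R P.J) :=
    {F | LinearMap.range j ≤ F ∧ ∀ N : Submodule R P.J, N ≤ F → N ⊓ LinearMap.range j = ⊥ → N = ⊥}
  obtain ⟨F, hle, hFmax⟩ := zorn_le_nonempty₀ S (by
    intro c hc hchain y hy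
    refine ⟨sSup c, ⟨(hc hy).1.trans (le_sSup hy), ?_⟩, fun z hz => le_sSup hz⟩
    intro N hN hNj
    rw [Submodule.eq_bot_iff]
    intro x hx
    obtain ⟨z, hz, hxz⟩ :=
      (Submodule.mem_sSup_of_directed ⟨y, hy⟩ hchain.directedOn).mp (hN hx)
    have h0 := (hc hz).2 (N ⊓ z) inf_le_right (by
      rw [eq_bot_iff, ← hNj]
      exact inf_le_inf_right _ inf_le_left)
    exact (Submodule.eq_bot_iff _).mp h0 x ⟨hx, hxz⟩)
    (LinearMap.range j) ⟨le_rfl, fun N hN h => by rwa [inf_eq_left.mpr hN] at h⟩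
  obtain ⟨C, -, hCmax⟩ := zorn_le_nonempty₀ {C : Submodule R P.J | C ⊓ F = ⊥} (by
    intro c hc hchain y hy
    refine ⟨sSup c, ?_, fun z hz => le_sSup hz⟩
    change sSup c ⊓ F = ⊥
    rw [Submodule.eq_bot_iff]
    rintro x ⟨hx, hxF⟩
    obtain ⟨z, hz, hxz⟩ :=
      (Submodule.mem_sSup_of_directed ⟨y, hy⟩ hchain.directedOn).mp hx
    exact (Submodule.eq_bot_iff _).mp (hc hz) x ⟨hxz, hxF⟩)
    ⊥ (by simp)
  have hCF : C ⊓ F = ⊥ := hCmax.prop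
  obtain ⟨h, hh⟩ := Module.Injective.extension_property R P.J F (P.J ⧸ C)
    (C.mkQ ∘ₗ F.subtype) (by
      rw [← LinearMap.ker_eq_bot, Submodule.eq_bot_iff]
      intro x hx
      have hxC : (x : P.J) ∈ C := by simpa using hx
      exact Subtype.ext ((Submodule.eq_bot_iff _).mp hCF x ⟨hxC, x.2⟩)) F.subtype
  let φ : P.J →ₗ[R] P.J := h ∘ₗ C.mkQ
  have hφF : ∀ x ∈ F, φ x = x := fun x hx => LinearMap.congr_fun hh ⟨x, hx⟩
  have hφC : ∀ x ∈ C, φ x = 0 := fun x hx => by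
    have : C.mkQ x = 0 := by simpa using hx
    simp [φ, this]
  have hFφ : F ≤ LinearMap.range φ := fun x hx => ⟨x, hφF x hx⟩
  have hmem : LinearMap.range φ ∈ S := by
    refine ⟨hFmax.prop.1.trans hFφ, fun N hN hNj => ?_⟩
    have hNF : N ⊓ F = ⊥ := hFmax.prop.2 _ inf_le_right (by
      rw [eq_bot_iff, ← hNj]
      exact inf_le_inf_right _ inf_le_left)
    have hcap : N.comap φ ⊓ F = ⊥ := by
      rw [Submodule.eq_bot_iff]
      rintro x ⟨hx, hxF⟩
      have hxN : φ x ∈ N := hx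
      rw [hφF x hxF] at hxN
      exact (Submodule.eq_bot_iff _).mp hNF x ⟨hxN, hxF⟩
    have hCle : C ≤ N.comap φ := fun x hx => by
      change φ x ∈ N
      rw [hφC x hx]
      exact N.zero_mem
    have hle' : N.comap φ ≤ C := hCmax.le_of_ge hcap hCle
    rw [Submodule.eq_bot_iff]
    intro x hx
    obtain ⟨y, rfl⟩ := hN hx
    exact hφC y (hle' hx)
  have hrange : LinearMap.range φ ≤ F := hFmax.le_of_ge hmem hFφ
  let ρ : P.J →ₗ[R] F := φ.codRestrict F fun x => hrange ⟨x, rfl⟩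
  refine ⟨F, inferInstance, inferInstance,
    j.codRestrict F fun x => hFmax.prop.1 ⟨x, rfl⟩, ?_, ?_, ?_⟩
  · intro x y hxy
    exact hj (congrArg Subtype.val hxy)
  · refine ⟨fun X Y _ _ _ _ f hf g => ?_⟩
    obtain ⟨k, hk⟩ := hI.out f hf (F.subtype ∘ₗ g)
    refine ⟨ρ ∘ₗ k, fun x => Subtype.ext ?_⟩
    have : k (f x) = g x := hk x
    change φ (k (f x)) = g x
    rw [this, hφF _ (g x).2]
  · intro N hN
    have h0 := hFmax.prop.2 (N.map F.subtype) (Submodule.map_subtype_le F N) (by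
      rw [Submodule.eq_bot_iff]
      rintro x ⟨⟨y, hy, rfl⟩, ⟨m, hm⟩⟩
      have : y = 0 := (Submodule.eq_bot_iff _).mp hN y ⟨hy, m, Subtype.ext hm⟩
      simp [this])
    exact (Submodule.map_injective_of_injective F.injective_subtype) (by simpa using h0)

/-! ## The module structure over the completion -/

section Torsion

variable {R : Type u} [CommRing R]

/-- `L` is `I`-torsion: every element of `L` is killed by some power of `I`. -/
def IsAdicTorsion (I : Ideal R) (L : Type u) [AddCommGroup L] [Module R L] : Prop :=
  ∀ x : L, ∃ n : ℕ, ∀ a ∈ I ^ n, a • x = 0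

/-- Every artinian module over a local ring is torsion for the maximal ideal. -/
theorem isAdicTorsion_of_isArtinian [IsLocalRing R] (L : Type u) [AddCommGroup L] [Module R L]
    [IsNoetherianRing R] [IsArtinian R L] : IsAdicTorsion (IsLocalRing.maximalIdeal R) L := by
  intro x
  set m := IsLocalRing.maximalIdeal R
  let T : Submodule R L := Submodule.span R {x}
  obtain ⟨n, hn⟩ := IsArtinian.monotone_stabilizes (R := R) (M := L)
    ⟨fun n => OrderDual.toDual (m ^ n • T), fun a b hab =>
      OrderDual.toDual_le_toDual.mpr (Submodule.smul_mono_left (Ideal.pow_le_pow_right hab))⟩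
  have h1 : m ^ n • T = m ^ (n + 1) • T := hn (n + 1) (Nat.le_succ n)
  have h2 : m ^ n • T = ⊥ := by
    refine Submodule.eq_bot_of_le_smul_of_le_jacobson_bot m _ ?_ ?_
      (IsLocalRing.maximalIdeal_le_jacobson _)
    · exact Submodule.FG.smul (IsNoetherian.noetherian (m ^ n)) (Submodule.fg_span_singleton x)
    · rw [← Submodule.mul_smul, ← pow_succ', ← h1]
  exact ⟨n, fun a ha => (Submodule.eq_bot_iff _).mp h2 _
    (Submodule.smul_mem_smul ha (Submodule.mem_span_singleton_self x))⟩

/-- The product of `r ∈ R̂` with an element `x` of an `I`-torsion module: choose `n` with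
`I ^ n x = 0` and `r₀ ∈ R` with the same image as `r` in `R / I ^ n`, and set `r x = r₀ x`. -/
noncomputable def torsionSMul {I : Ideal R} {L : Type u} [AddCommGroup L] [Module R L]
    (hL : IsAdicTorsion I L) (r : AdicCompletion I R) (x : L) : L :=
  Quotient.out (AdicCompletion.evalₐ I (hL x).choose r) • x

/-- The product does not depend on the choices. -/
theorem torsionSMul_eq {I : Ideal R} {L : Type u} [AddCommGroup L] [Module R L]
    (hL : IsAdicTorsion I L) (r : AdicCompletion I R) (x : L) (n : ℕ)
    (hn : ∀ a ∈ I ^ n, a • x = 0) (r₀ : R)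
    (hr : AdicCompletion.evalₐ I n r = Ideal.Quotient.mk (I ^ n) r₀) :
    torsionSMul hL r x = r₀ • x := by
  set k := (hL x).choose with hk
  have hkx : ∀ a ∈ I ^ k, a • x = 0 := (hL x).choose_spec
  obtain ⟨t, ht⟩ := Ideal.Quotient.mk_surjective (AdicCompletion.evalₐ I (max k n) r)
  have key : ∀ (l : ℕ) (_ : l ≤ max k n) (s : R), (∀ a ∈ I ^ l, a • x = 0) →
      AdicCompletion.evalₐ I l r = Ideal.Quotient.mk (I ^ l) s → s • x = t • x := by
    intro l hl s hs hls
    have h1 : AdicCompletion.evalₐ I l r = Ideal.Quotient.mk (I ^ l) t := by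
      induction r using AdicCompletion.induction_on with
      | _ f =>
        rw [AdicCompletion.evalₐ_mk] at ht ⊢
        rw [Ideal.Quotient.eq] at ht ⊢
        have h2 := AdicCompletion.AdicCauchySequence.mk_eq_mk hl f
        rw [Submodule.Quotient.eq] at h2
        have h3 : f (max k n) - f l ∈ I ^ l := by simpa using h2
        have h4 : t - f (max k n) ∈ I ^ l := Ideal.pow_le_pow_right hl ht
        have h5 := neg_mem (add_mem h4 h3)
        rwa [sub_add_sub_cancel, neg_sub] at h5
    rw [h1, eq_comm, Ideal.Quotient.eq] at hls
    have := hs _ hls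
    rwa [sub_smul, sub_eq_zero] at this
  rw [key n (le_max_right _ _) r₀ hn hr]
  exact key k (le_max_left _ _) _ hkx (Ideal.Quotient.mk_out _).symm

theorem IsAdicTorsion.exists_common {I : Ideal R} {L : Type u} [AddCommGroup L] [Module R L]
    (hL : IsAdicTorsion I L) (x y : L) :
    ∃ n : ℕ, (∀ a ∈ I ^ n, a • x = 0) ∧ ∀ a ∈ I ^ n, a • y = 0 := by
  obtain ⟨n, hn⟩ := hL x
  obtain ⟨k, hk⟩ := hL y
  exact ⟨max n k, fun a ha => hn a (Ideal.pow_le_pow_right (le_max_left _ _) ha),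
    fun a ha => hk a (Ideal.pow_le_pow_right (le_max_right _ _) ha)⟩

/-- The canonical module structure over the `I`-adic completion on an `I`-torsion module. -/
@[reducible] noncomputable def torsionModule {I : Ideal R} {L : Type u} [AddCommGroup L]
    [Module R L] (hL : IsAdicTorsion I L) : Module (AdicCompletion I R) L where
  smul := torsionSMul hL
  one_smul x := by
    obtain ⟨n, hn⟩ := hL x
    exact (torsionSMul_eq hL 1 x n hn 1 (by simp)).trans (one_smul R x)
  mul_smul r s x := by
    obtain ⟨n, hn⟩ := hL x
    obtain ⟨r₀, hr⟩ := Ideal.Quotient.mk_surjective (AdicCompletion.evalₐ I n r)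
    obtain ⟨s₀, hs⟩ := Ideal.Quotient.mk_surjective (AdicCompletion.evalₐ I n s)
    change torsionSMul hL (r * s) x = torsionSMul hL r (torsionSMul hL s x)
    rw [torsionSMul_eq hL s x n hn s₀ hs.symm,
      torsionSMul_eq hL r (s₀ • x) n (fun a ha => by rw [smul_comm, hn a ha, smul_zero]) r₀ hr.symm,
      torsionSMul_eq hL (r * s) x n hn (r₀ * s₀) (by rw [map_mul, map_mul, hr, hs]), mul_smul]
  smul_zero r := smul_zero (M := R) (A := L) _
  smul_add r x y := by
    obtain ⟨n, hx, hy⟩ := hL.exists_common x y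
    obtain ⟨r₀, hr⟩ := Ideal.Quotient.mk_surjective (AdicCompletion.evalₐ I n r)
    change torsionSMul hL r (x + y) = torsionSMul hL r x + torsionSMul hL r y
    rw [torsionSMul_eq hL r x n hx r₀ hr.symm, torsionSMul_eq hL r y n hy r₀ hr.symm,
      torsionSMul_eq hL r (x + y) n (fun a ha => by rw [smul_add, hx a ha, hy a ha, add_zero])
        r₀ hr.symm, smul_add]
  add_smul r s x := by
    obtain ⟨n, hn⟩ := hL x
    obtain ⟨r₀, hr⟩ := Ideal.Quotient.mk_surjective (AdicCompletion.evalₐ I n r)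
    obtain ⟨s₀, hs⟩ := Ideal.Quotient.mk_surjective (AdicCompletion.evalₐ I n s)
    change torsionSMul hL (r + s) x = torsionSMul hL r x + torsionSMul hL s x
    rw [torsionSMul_eq hL s x n hn s₀ hs.symm, torsionSMul_eq hL r x n hn r₀ hr.symm,
      torsionSMul_eq hL (r + s) x n hn (r₀ + s₀) (by rw [map_add, map_add, hr, hs]), add_smul]
  zero_smul x := by
    obtain ⟨n, hn⟩ := hL x
    exact (torsionSMul_eq hL 0 x n hn 0 (by simp)).trans (zero_smul R x)

theorem torsionSMul_smul {I : Ideal R} {L : Type u} [AddCommGroup L] [Module R L]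
    (hL : IsAdicTorsion I L) (r : AdicCompletion I R) (c : R) (x : L) :
    torsionSMul hL r (c • x) = c • torsionSMul hL r x := by
  obtain ⟨n, hn⟩ := hL x
  obtain ⟨r₀, hr⟩ := Ideal.Quotient.mk_surjective (AdicCompletion.evalₐ I n r)
  rw [torsionSMul_eq hL r x n hn r₀ hr.symm,
    torsionSMul_eq hL r (c • x) n (fun a ha => by rw [smul_comm, hn a ha, smul_zero]) r₀ hr.symm,
    smul_comm]

/-- Multiplication by `r ∈ R̂` as an `R`-linear endomorphism of an `I`-torsion module `L`. -/
noncomputable def torsionMulLeft {I : Ideal R} {L : Type u} [AddCommGroup L] [Module R L]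
    (hL : IsAdicTorsion I L) (r : AdicCompletion I R) : L →ₗ[R] L where
  toFun := torsionSMul hL r
  map_add' := (torsionModule hL).smul_add r
  map_smul' := torsionSMul_smul hL r

/-- For an `I`-torsion module `L`, the module structure of `Hom_R(L, E)` over the `I`-adic
completion of `R` that is induced by the one of `L`: `(r f)(x) = f (r x)`. -/
@[reducible] noncomputable def torsionDualModule {I : Ideal R} {L : Type u} [AddCommGroup L]
    [Module R L] (hL : IsAdicTorsion I L) (E : Type u) [AddCommGroup E] [Module R E] :
    Module (AdicCompletion I R) (L →ₗ[R] E) where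
  smul r f := f ∘ₗ torsionMulLeft hL r
  one_smul f := LinearMap.ext fun x => congrArg f ((torsionModule hL).one_smul x)
  mul_smul r s f := LinearMap.ext fun x => congrArg f <| by
    change torsionSMul hL (r * s) x = torsionSMul hL s (torsionSMul hL r x)
    rw [mul_comm]
    exact (torsionModule hL).mul_smul s r x
  smul_zero r := LinearMap.zero_comp _
  smul_add r f g := LinearMap.add_comp (torsionMulLeft hL r) g f
  add_smul r s f := LinearMap.ext fun x =>
    (congrArg f ((torsionModule hL).add_smul r s x)).trans (map_add f _ _)
  zero_smul f := LinearMap.ext fun x =>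
    (congrArg f ((torsionModule hL).zero_smul x)).trans (map_zero f)

end Torsion

/-! ## Vanishing of Ext and depth -/

/-- `inf {i ≥ 0 | Ext^i_R(L, L') ≠ 0}`, which is `⊤` when all these modules vanish. -/
noncomputable def extInf (R : Type u) [CommRing R] (L L' : Type u) [AddCommGroup L] [Module R L]
    [AddCommGroup L'] [Module R L'] : ℕ∞ :=
  sInf ((fun i : ℕ => (i : ℕ∞)) '' {i : ℕ | Nontrivial
    (CategoryTheory.Abelian.Ext (ModuleCat.of R L) (ModuleCat.of R L') i)})

/-- `depth_R(𝔞; L) = inf {i ≥ 0 | Ext^i_R(R/𝔞, L) ≠ 0}`. -/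
noncomputable def idealDepth (R : Type u) [CommRing R] (𝔞 : Ideal R) (L : Type u)
    [AddCommGroup L] [Module R L] : ℕ∞ :=
  extInf R (R ⧸ 𝔞) L

/-! Each depth is first turned into a first nonvanishing Ext. For a finitely generated module M over
a noetherian ring and an arbitrary module L, `idealDepth_annihilator_eq_extInf` says that the first
nonzero Ext^i(M, L) sits in degree depth(Ann M; L). Vanishing of Ext^i(M, L) for all i below a bound
is equivalent to vanishing of Ext^i(R/𝔭, L) in that range for all primes 𝔭 ⊇ Ann M, a condition that
depends on M only through its annihilator. One direction is a prime filtration. The other,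
`ExtVanishes.prime_of_finite`, is a noetherian induction on 𝔭.

It remains to compare Ext modules degree by degree, by three dualities. Each is proved by dimension
shifting, starting from a statement about Hom.

Ext^i_R(A, N'^∨) and Ext^i_R(N', A^∨) vanish together, by swapping arguments in bilinear maps to E;
the dual of a free cover is an embedding into an injective (`extVanishes_dual_comm`). This gives the
second equality.

Ext^i_R(N^∨, N'^∨) and Ext^i_R(N', N) vanish together, because Hom(P, N)^∨∨ ≅ Hom(N^∨, P^∨)
naturally for finitely generated P, and E is an injective cogenerator (`extVanishes_dual_dual_iff`).
This gives the third.

For the first, Matlis duality is needed over the completion: End_R(E) is the completion of R, so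
duality is fully faithful on artinian modules, sends E^n to a free module, and sends artinian
modules to finitely generated ones. Hence Ext^i_R(A, A') and Ext^i(A'^∨, A^∨) over the completion
vanish together (`IsInjectiveHull.extVanishes_torsionDual_iff`). Since the completion is noetherian
and A'^∨ has the same annihilator as A', the depth criterion applies there. -/

open CategoryTheory CategoryTheory.Abelian

/-! ## Vanishing of Ext over a ring -/

/-- `Ext^i_R(L, L') = 0`. -/
abbrev ExtVanishes (R : Type u) [CommRing R] (L L' : Type u) [AddCommGroup L] [Module R L]
    [AddCommGroup L'] [Module R L'] (i : ℕ) : Prop :=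
  Subsingleton (Ext (ModuleCat.of R L) (ModuleCat.of R L') i)

theorem natCast_le_extInf_iff {R : Type u} [CommRing R] {L L' : Type u} [AddCommGroup L]
    [Module R L] [AddCommGroup L'] [Module R L'] (n : ℕ) :
    (n : ℕ∞) ≤ extInf R L L' ↔ ∀ i < n, ExtVanishes R L L' i := by
  simp only [extInf, le_sInf_iff, Set.forall_mem_image, Set.mem_ofPred_eq, Nat.cast_le]
  refine ⟨fun h i hi => ?_, fun h i hi => ?_⟩
  · by_contra hne
    exact absurd (h (not_subsingleton_iff_nontrivial.mp hne)) (by omega)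
  · by_contra hlt
    exact not_subsingleton_iff_nontrivial.mpr hi (h i (by omega))

/-- Only vanishing on initial ranges of degrees has to be compared. The depth criterion needs this
weaker form, since above the first nonzero degree the two sides may vanish in different degrees. -/
theorem extInf_eq_of_forall_lt_iff {R S : Type u} [CommRing R] [CommRing S] {L L' : Type u}
    [AddCommGroup L] [Module R L] [AddCommGroup L'] [Module R L'] {M M' : Type u}
    [AddCommGroup M] [Module S M] [AddCommGroup M'] [Module S M']
    (h : ∀ n : ℕ, (∀ i < n, ExtVanishes R L L' i) ↔ ∀ i < n, ExtVanishes S M M' i) :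
    extInf R L L' = extInf S M M' := by
  refine ENat.eq_of_forall_natCast_le_iff fun n => ?_
  rw [natCast_le_extInf_iff, natCast_le_extInf_iff, h]

theorem extInf_congr {R S : Type u} [CommRing R] [CommRing S] {L L' : Type u}
    [AddCommGroup L] [Module R L] [AddCommGroup L'] [Module R L'] {M M' : Type u}
    [AddCommGroup M] [Module S M] [AddCommGroup M'] [Module S M']
    (h : ∀ i : ℕ, ExtVanishes R L L' i ↔ ExtVanishes S M M' i) :
    extInf R L L' = extInf S M M' :=
  extInf_eq_of_forall_lt_iff fun _ => forall₂_congr fun i _ => h i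

section ExtVanishes

variable {R : Type u} [CommRing R] {M₁ M₂ M₃ L : Type u}
  [AddCommGroup M₁] [Module R M₁] [AddCommGroup M₂] [Module R M₂]
  [AddCommGroup M₃] [Module R M₃] [AddCommGroup L] [Module R L]

theorem extVanishes_zero_iff : ExtVanishes R M₁ L 0 ↔ Subsingleton (M₁ →ₗ[R] L) :=
  (Ext.addEquiv₀.trans ModuleCat.homAddEquiv).toEquiv.subsingleton_congr

theorem ModuleCat.shortExact_of_exact {f : M₁ →ₗ[R] M₂} {g : M₂ →ₗ[R] M₃}
    (hf : Function.Injective f) (hg : Function.Surjective g) (hfg : Function.Exact f g) :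
    (ShortComplex.mk (ModuleCat.ofHom f) (ModuleCat.ofHom g)
      (by ext x; exact hfg.apply_apply_eq_zero x)).ShortExact where
  exact := (ShortComplex.moduleCat_exact_iff _).mpr fun x hx => (hfg x).mp hx
  mono_f := (ModuleCat.mono_iff_injective _).mpr hf
  epi_g := (ModuleCat.epi_iff_surjective _).mpr hg

variable {f : M₁ →ₗ[R] M₂} {g : M₂ →ₗ[R] M₃}

theorem ExtVanishes.of_exact (hf : Function.Injective f) (hg : Function.Surjective g)
    (hfg : Function.Exact f g) {i : ℕ} (h₁ : ExtVanishes R M₁ L i) (h₃ : ExtVanishes R M₃ L i) :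
    ExtVanishes R M₂ L i := by
  refine subsingleton_of_forall_eq 0 fun x => ?_
  obtain ⟨y, rfl⟩ := Ext.contravariant_sequence_exact₂
    (ModuleCat.shortExact_of_exact hf hg hfg) _ x (h₁.elim _ _)
  rw [h₃.elim y 0]
  simp

theorem ExtVanishes.of_linearEquiv (e : M₁ ≃ₗ[R] M₂) {i : ℕ} (h : ExtVanishes R M₁ L i) :
    ExtVanishes R M₂ L i := by
  refine subsingleton_of_forall_eq 0 fun x => ?_
  have h1 : (Ext.mk₀ (ModuleCat.ofHom e.symm.toLinearMap)).comp
      ((Ext.mk₀ (ModuleCat.ofHom e.toLinearMap)).comp x (zero_add i)) (zero_add i) = x := by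
    rw [Ext.mk₀_comp_mk₀_assoc, ← ModuleCat.ofHom_comp]
    simp
  rw [← h1, h.elim ((Ext.mk₀ (ModuleCat.ofHom e.toLinearMap)).comp x (zero_add i)) 0]
  simp

theorem ExtVanishes.succ_of_exact (hf : Function.Injective f) (hg : Function.Surjective g)
    (hfg : Function.Exact f g) {i : ℕ} (h₁ : ExtVanishes R M₁ L i)
    (h₂ : ExtVanishes R M₂ L (i + 1)) : ExtVanishes R M₃ L (i + 1) := by
  refine subsingleton_of_forall_eq 0 fun x => ?_
  obtain ⟨y, rfl⟩ := Ext.contravariant_sequence_exact₃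
    (ModuleCat.shortExact_of_exact hf hg hfg) _ x (h₂.elim _ _) (add_comm 1 i)
  rw [h₁.elim y 0]
  simp

theorem ExtVanishes.zero_of_surjective (hg : Function.Surjective g)
    (h₂ : ExtVanishes R M₂ L 0) : ExtVanishes R M₃ L 0 := by
  rw [extVanishes_zero_iff] at h₂ ⊢
  exact ⟨fun a b => (LinearMap.cancel_right hg).mp (h₂.elim _ _)⟩

/-- If an injective map `f : M₁ → M₂`, whose cokernel has vanishing `Ext^i`, factors through a
module with vanishing `Ext^i`, then `Ext^i(M₂, L) = 0`. -/
theorem ExtVanishes.of_factor {J : Type u} [AddCommGroup J] [Module R J]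
    (hf : Function.Injective f) (hg : Function.Surjective g)
    (hfg : Function.Exact f g) {i : ℕ} (h₃ : ExtVanishes R M₃ L i) {k : M₁ →ₗ[R] J}
    {l : J →ₗ[R] M₂} (hkl : l ∘ₗ k = f) (hJ : ExtVanishes R J L i) : ExtVanishes R M₂ L i := by
  refine subsingleton_of_forall_eq 0 fun x => ?_
  obtain ⟨y, rfl⟩ := Ext.contravariant_sequence_exact₂
    (ModuleCat.shortExact_of_exact hf hg hfg) _ x (by
      change (Ext.mk₀ (ModuleCat.ofHom f)).comp x (zero_add i) = 0
      rw [← hkl, ModuleCat.ofHom_comp, ← Ext.mk₀_comp_mk₀_assoc,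
        hJ.elim ((Ext.mk₀ (ModuleCat.ofHom l)).comp x (zero_add i)) 0]
      simp)
  rw [h₃.elim y 0]
  simp

theorem extVanishes_succ_of_projective [Module.Projective R M₁] (i : ℕ) :
    ExtVanishes R M₁ L (i + 1) :=
  have : Projective (ModuleCat.of R M₁) := (IsProjective.iff_projective M₁).mp inferInstance
  subsingleton_of_forall_eq 0 fun x => Ext.eq_zero_of_projective x

theorem extVanishes_succ_of_injective (hL : Module.Injective R L) (i : ℕ) :
    ExtVanishes R M₁ L (i + 1) :=
  have : Injective (ModuleCat.of R L) := (Module.injective_iff_injective_object R L).mp hL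
  subsingleton_of_forall_eq 0 fun x => Ext.eq_zero_of_injective x

theorem extVanishes_add_two_iff_of_projective [Module.Projective R M₂]
    (hf : Function.Injective f) (hg : Function.Surjective g)
    (hfg : Function.Exact f g) (i : ℕ) :
    ExtVanishes R M₃ L (i + 2) ↔ ExtVanishes R M₁ L (i + 1) := by
  refine ⟨fun h => ?_, fun h => h.succ_of_exact hf hg hfg (extVanishes_succ_of_projective _)⟩
  refine subsingleton_of_forall_eq 0 fun x => ?_
  obtain ⟨y, rfl⟩ := Ext.contravariant_sequence_exact₁
    (ModuleCat.shortExact_of_exact hf hg hfg) _ x (add_comm 1 (i + 1)) (h.elim _ _)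
  rw [(extVanishes_succ_of_projective (M₁ := M₂) i).elim y 0]
  simp

/-- Dimension shifting does not reach degree one, where Ext^1 is the cokernel of restriction on Hom.
Stated as surjectivity, this can be carried across a natural bijection of Hom modules. -/
theorem extVanishes_one_iff_of_projective [Module.Projective R M₂]
    (hf : Function.Injective f) (hg : Function.Surjective g) (hfg : Function.Exact f g) :
    ExtVanishes R M₃ L 1 ↔ Function.Surjective (LinearMap.lcomp R L f) := by
  have hS := ModuleCat.shortExact_of_exact hf hg hfg
  refine ⟨fun h φ => ?_, fun h => ?_⟩
  · obtain ⟨y, hy⟩ := Ext.contravariant_sequence_exact₁ hS (ModuleCat.of R L)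
      (Ext.mk₀ (ModuleCat.ofHom φ)) (add_comm 1 0) (h.elim _ _)
    obtain ⟨ψ, rfl⟩ := (Ext.mk₀_bijective _ _).2 y
    rw [Ext.mk₀_comp_mk₀] at hy
    exact ⟨ψ.hom, congrArg ModuleCat.Hom.hom ((Ext.mk₀_bijective _ _).1 hy)⟩
  · refine subsingleton_of_forall_eq 0 fun x => ?_
    obtain ⟨y, rfl⟩ := Ext.contravariant_sequence_exact₃ hS _ x
      ((extVanishes_succ_of_projective (M₁ := M₂) 0).elim _ _) (add_comm 1 0)
    obtain ⟨φ, rfl⟩ := (Ext.mk₀_bijective _ _).2 y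
    obtain ⟨ψ, hψ⟩ := h φ.hom
    have : φ = ModuleCat.ofHom f ≫ ModuleCat.ofHom ψ := by
      ext1
      exact hψ.symm
    rw [this, ← Ext.mk₀_comp_mk₀]
    exact ShortComplex.ShortExact.extClass_comp_assoc hS _

theorem extVanishes_add_two_iff_of_injective (hM₂ : Module.Injective R M₂)
    (hf : Function.Injective f) (hg : Function.Surjective g)
    (hfg : Function.Exact f g) (i : ℕ) :
    ExtVanishes R L M₁ (i + 2) ↔ ExtVanishes R L M₃ (i + 1) := by
  have hS := ModuleCat.shortExact_of_exact hf hg hfg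
  refine ⟨fun h => subsingleton_of_forall_eq 0 fun x => ?_,
    fun h => subsingleton_of_forall_eq 0 fun x => ?_⟩
  · obtain ⟨y, rfl⟩ := Ext.covariant_sequence_exact₃ _ hS x rfl (h.elim _ _)
    rw [(extVanishes_succ_of_injective (M₁ := L) hM₂ i).elim y 0]
    simp
  · obtain ⟨y, rfl⟩ := Ext.covariant_sequence_exact₁ _ hS x
      ((extVanishes_succ_of_injective (M₁ := L) hM₂ (i + 1)).elim _ _) rfl
    rw [h.elim y 0]
    simp

theorem extVanishes_one_iff_of_injective (hM₂ : Module.Injective R M₂)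
    (hf : Function.Injective f) (hg : Function.Surjective g) (hfg : Function.Exact f g) :
    ExtVanishes R L M₁ 1 ↔ Function.Surjective (LinearMap.compRight R (M := L) g) := by
  have hS := ModuleCat.shortExact_of_exact hf hg hfg
  refine ⟨fun h φ => ?_, fun h => ?_⟩
  · obtain ⟨y, hy⟩ := Ext.covariant_sequence_exact₃ (ModuleCat.of R L) hS
      (Ext.mk₀ (ModuleCat.ofHom φ)) (zero_add 1) (h.elim _ _)
    obtain ⟨ψ, rfl⟩ := (Ext.mk₀_bijective _ _).2 y
    rw [Ext.mk₀_comp_mk₀] at hy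
    exact ⟨ψ.hom, congrArg ModuleCat.Hom.hom ((Ext.mk₀_bijective _ _).1 hy)⟩
  · refine subsingleton_of_forall_eq 0 fun x => ?_
    obtain ⟨y, rfl⟩ := Ext.covariant_sequence_exact₁ _ hS x
      ((extVanishes_succ_of_injective (M₁ := L) hM₂ 0).elim _ _) (zero_add 1)
    obtain ⟨φ, rfl⟩ := (Ext.mk₀_bijective _ _).2 y
    obtain ⟨ψ, hψ⟩ := h φ.hom
    have : φ = ModuleCat.ofHom ψ ≫ ModuleCat.ofHom g := by
      ext1
      exact hψ.symm
    rw [this, ← Ext.mk₀_comp_mk₀]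
    rw [Ext.comp_assoc_of_second_deg_zero]
    erw [ShortComplex.ShortExact.comp_extClass hS]
    simp

end ExtVanishes

/-! ## Vanishing of Ext and prime ideals -/

section Depth

variable {R : Type u} [CommRing R] {L : Type u} [AddCommGroup L] [Module R L]

theorem annihilator_le_of_exact {M₁ M₂ M₃ : Type u} [AddCommGroup M₁] [Module R M₁]
    [AddCommGroup M₂] [Module R M₂] [AddCommGroup M₃] [Module R M₃] {f : M₁ →ₗ[R] M₂}
    {g : M₂ →ₗ[R] M₃} (hf : Function.Injective f) (hg : Function.Surjective g) :
    Module.annihilator R M₂ ≤ Module.annihilator R M₁ ∧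
      Module.annihilator R M₂ ≤ Module.annihilator R M₃ :=
  ⟨f.annihilator_le_of_injective hf, g.annihilator_le_of_surjective hg⟩

theorem extVanishes_of_subsingleton {M : Type u} [AddCommGroup M] [Module R M] [Subsingleton M]
    (i : ℕ) : ExtVanishes R M L i := by
  refine subsingleton_of_forall_eq 0 fun x => ?_
  rw [← Ext.mk₀_id_comp x,
    (ModuleCat.isZero_of_subsingleton (ModuleCat.of R M)).eq_of_src (𝟙 _) 0]
  simp

/-- `Ext^i(M, L)` vanishes when `Ext^i(R/𝔭, L)` does for every prime `𝔭` containing the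
annihilator of the finitely generated module `M`. -/
theorem ExtVanishes.of_forall_prime [IsNoetherianRing R] (M : Type u) [AddCommGroup M]
    [Module R M] (hM : Module.Finite R M) (i : ℕ)
    (h : ∀ p : Ideal R, p.IsPrime → Module.annihilator R M ≤ p → ExtVanishes R (R ⧸ p) L i) :
    ExtVanishes R M L i := by
  induction hM using IsNoetherianRing.induction_on_isQuotientEquivQuotientPrime R with
  | subsingleton N =>
    exact extVanishes_of_subsingleton i
  | quotient N p e =>
    refine ExtVanishes.of_linearEquiv e.symm (h p.1 p.2 ?_)
    rw [e.annihilator_eq, Ideal.annihilator_quotient]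
  | exact N₁ N₂ N₃ f g hf hg hfg h₁ h₃ =>
    have hle := annihilator_le_of_exact hf hg
    exact ExtVanishes.of_exact hf hg hfg (h₁ fun p hp hap => h p hp (hle.1.trans hap))
      (h₃ fun p hp hap => h p hp (hle.2.trans hap))

/-- A finitely generated module maps nontrivially to `R/𝔭` for every prime `𝔭` in its support. -/
theorem nontrivial_linearMap_quotient_prime [IsNoetherianRing R] (M : Type u) [AddCommGroup M]
    [Module R M] [Module.Finite R M] (p : Ideal R) [p.IsPrime]
    (hp : Module.annihilator R M ≤ p) : Nontrivial (M →ₗ[R] R ⧸ p) := by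
  -- If Hom(M, R/𝔭) were zero, Ann M would contain an element regular on R/𝔭; but Ann M ⊆ 𝔭 kills
  -- R/𝔭.
  rw [← not_subsingleton_iff_nontrivial, IsSMulRegular.subsingleton_linearMap_iff]
  rintro ⟨r, hr, hreg⟩
  refine one_ne_zero (α := R ⧸ p) (hreg ?_)
  change r • (1 : R ⧸ p) = r • (0 : R ⧸ p)
  rw [smul_zero, Algebra.smul_def, mul_one]
  exact Ideal.Quotient.eq_zero_iff_mem.mpr (hp hr)

/-- Noetherian induction on 𝔭, larger primes first. A nonzero φ : M → R/𝔭 has image J with Ext^i(J,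
L) = 0. Multiplication by a nonzero element of J on R/𝔭 factors through J, and its cokernel is
supported on strictly larger primes, so Ext^i(R/𝔭, L) is squeezed to zero. -/
theorem ExtVanishes.prime_of_finite [IsNoetherianRing R] (M : Type u) [AddCommGroup M]
    [Module R M] [Module.Finite R M] (i : ℕ) (hM : ExtVanishes R M L i)
    (hlt : ∀ j < i, ∀ p : Ideal R, p.IsPrime → Module.annihilator R M ≤ p →
      ExtVanishes R (R ⧸ p) L j) (p : Ideal R) (hp : p.IsPrime)
    (hMp : Module.annihilator R M ≤ p) : ExtVanishes R (R ⧸ p) L i := by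
  induction p using IsNoetherian.induction with
  | hgt p ih =>
  have := nontrivial_linearMap_quotient_prime M p hMp
  obtain ⟨φ, hφ⟩ := exists_ne (0 : M →ₗ[R] R ⧸ p)
  -- Ext^i(J, L) lies between Ext^(i-1)(ker φ, L) and Ext^i(M, L). The former vanishes by the
  -- hypothesis in lower degrees, as Ann M ⊆ Ann(ker φ).
  have hJ : ExtVanishes R (LinearMap.range φ) L i := by
    have hs := φ.surjective_rangeRestrict
    cases i with
    | zero => exact ExtVanishes.zero_of_surjective hs hM
    | succ j =>
      refine ExtVanishes.succ_of_exact (LinearMap.ker φ).injective_subtype hs (fun x => ?_) ?_ hM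
      · rw [Submodule.coe_subtype, Subtype.range_coe, ← LinearMap.ker_rangeRestrict]
        rfl
      · refine ExtVanishes.of_forall_prime _ inferInstance j fun q hq hle =>
          hlt j j.lt_succ_self q hq (le_trans ?_ hle)
        exact (LinearMap.ker φ).subtype.annihilator_le_of_injective
          (LinearMap.ker φ).injective_subtype
  obtain ⟨m, hm⟩ : ∃ m, φ m ≠ 0 := by
    by_contra! h
    exact hφ (LinearMap.ext h)
  obtain ⟨x, hx⟩ := Ideal.Quotient.mk_surjective (φ m)
  have hxp : x ∉ p := fun h => hm (hx ▸ Ideal.Quotient.eq_zero_iff_mem.mpr h)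
  let μ : (R ⧸ p) →ₗ[R] R ⧸ p := LinearMap.lsmul R (R ⧸ p) x
  have hμ : Function.Injective μ := by
    rw [injective_iff_map_eq_zero]
    intro y hy
    obtain ⟨y, rfl⟩ := Ideal.Quotient.mk_surjective y
    have : Ideal.Quotient.mk p (x * y) = 0 := hy
    rw [Ideal.Quotient.eq_zero_iff_mem] at this ⊢
    exact (hp.mem_or_mem this).resolve_left hxp
  -- Sends 1 to φ(m) in the image of φ; followed by the inclusion it is multiplication by x.
  let κ : (R ⧸ p) →ₗ[R] LinearMap.range φ :=
    p.liftQ (LinearMap.toSpanSingleton R _ (φ.rangeRestrict m)) fun a ha => by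
      refine Subtype.ext ?_
      change a • φ m = 0
      rw [← hx]
      exact Ideal.Quotient.eq_zero_iff_mem.mpr (Ideal.mul_mem_right x p ha)
  refine ExtVanishes.of_factor (f := μ) (g := (LinearMap.range μ).mkQ) hμ
    (Submodule.mkQ_surjective _) (LinearMap.exact_map_mkQ_range _) ?_ (k := κ)
    (l := (LinearMap.range φ).subtype) ?_ hJ
  · have hpQ : p ≤ Module.annihilator R ((R ⧸ p) ⧸ LinearMap.range μ) :=
      Ideal.annihilator_quotient.ge.trans
        ((LinearMap.range μ).mkQ.annihilator_le_of_surjective (Submodule.mkQ_surjective _))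
    refine ExtVanishes.of_forall_prime _ inferInstance i fun q hq hle =>
      ih q ?_ hq (hMp.trans (hpQ.trans hle))
    · have hpq : p ≤ q := hpQ.trans hle
      -- The inclusion is strict because x kills the cokernel, hence lies in q, but not in p.
      refine lt_of_le_of_ne hpq fun h => hxp (h ▸ hle ?_)
      rw [Module.mem_annihilator]
      intro z
      obtain ⟨z, rfl⟩ := Submodule.mkQ_surjective _ z
      rw [← map_smul, Submodule.mkQ_apply, Submodule.Quotient.mk_eq_zero]
      exact ⟨z, rfl⟩
  · ext
    change (1 : R) • φ m = x • (1 : R ⧸ p)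
    rw [one_smul, ← hx, Algebra.smul_def, mul_one]
    rfl

theorem forall_lt_extVanishes_iff [IsNoetherianRing R] (M : Type u) [AddCommGroup M]
    [Module R M] [Module.Finite R M] (n : ℕ) :
    (∀ i < n, ExtVanishes R M L i) ↔ ∀ i < n, ∀ p : Ideal R, p.IsPrime →
      Module.annihilator R M ≤ p → ExtVanishes R (R ⧸ p) L i := by
  refine ⟨fun h i => ?_, fun h i hi => ExtVanishes.of_forall_prime M inferInstance i (h i hi)⟩
  induction i using Nat.strong_induction_on with
  | _ i ih =>
    intro hi
    exact ExtVanishes.prime_of_finite M i (h i hi) fun j hj => ih j hj (hj.trans hi)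

/-- For a finitely generated module `M` over a noetherian ring and an arbitrary module `L`, the
first nonvanishing `Ext^i(M, L)` is in degree `depth(Ann M; L)`. -/
theorem idealDepth_annihilator_eq_extInf [IsNoetherianRing R] (M : Type u) [AddCommGroup M]
    [Module R M] [Module.Finite R M] (L : Type u) [AddCommGroup L] [Module R L] :
    idealDepth R (Module.annihilator R M) L = extInf R M L := by
  refine extInf_eq_of_forall_lt_iff fun n => ?_
  rw [forall_lt_extVanishes_iff, forall_lt_extVanishes_iff, Ideal.annihilator_quotient]

end Depth

/-! ## Duality with respect to an injective cogenerator -/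

/-- `E` is a cogenerator: every nonzero element of an `R`-module is detected by a map to `E`. -/
def IsCogenerator (R : Type u) [CommRing R] (E : Type u) [AddCommGroup E] [Module R E] : Prop :=
  ∀ (M : Type u) [AddCommGroup M] [Module R M] (x : M), x ≠ 0 → ∃ f : M →ₗ[R] E, f x ≠ 0

section Dual

variable {R : Type u} [CommRing R] {E : Type u} [AddCommGroup E] [Module R E]

/-- The cyclic module Rx ≅ R/I is nonzero, so it surjects onto the residue field, which embeds in E.
Injectivity of E extends the composite to M, and x goes to ι(1) ≠ 0. -/
theorem IsInjectiveHull.isCogenerator [IsLocalRing R]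
    {ι : IsLocalRing.ResidueField R →ₗ[R] E} (hE : IsInjectiveHull ι) : IsCogenerator R E := by
  intro M _ _ x hx
  let I : Ideal R := LinearMap.ker (LinearMap.toSpanSingleton R M x)
  have hI : I ≤ IsLocalRing.maximalIdeal R := by
    refine IsLocalRing.le_maximalIdeal fun h => hx ?_
    have : (1 : R) ∈ I := h ▸ Submodule.mem_top
    simpa [I] using this
  obtain ⟨h, hh⟩ := hE.injective_module.out (I.liftQ (LinearMap.toSpanSingleton R M x) le_rfl)
    (LinearMap.ker_eq_bot.mp (Submodule.ker_liftQ_eq_bot _ _ _ le_rfl))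
    (ι ∘ₗ I.liftQ (Algebra.linearMap R (IsLocalRing.ResidueField R)) fun a ha => by
      simpa using hI ha)
  refine ⟨h, fun h0 => ?_⟩
  have h1 := hh (I.mkQ 1)
  simp only [Submodule.mkQ_apply, Submodule.liftQ_apply, LinearMap.toSpanSingleton_apply, one_smul,
    h0, LinearMap.coe_comp, Function.comp_apply, Algebra.linearMap_apply, map_one] at h1
  exact one_ne_zero (hE.injective_map (h1.symm.trans (map_zero ι).symm))

variable {M₁ M₂ M₃ : Type u} [AddCommGroup M₁] [Module R M₁] [AddCommGroup M₂] [Module R M₂]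
  [AddCommGroup M₃] [Module R M₃] {f : M₁ →ₗ[R] M₂} {g : M₂ →ₗ[R] M₃}

theorem lcomp_injective_of_surjective {L : Type u} [AddCommGroup L] [Module R L]
    (hg : Function.Surjective g) : Function.Injective (LinearMap.lcomp R L g) :=
  fun _ _ h => (LinearMap.cancel_right hg).mp h

theorem lcomp_exact {L : Type u} [AddCommGroup L] [Module R L] (hg : Function.Surjective g)
    (hfg : Function.Exact f g) :
    Function.Exact (LinearMap.lcomp R L g) (LinearMap.lcomp R L f) := by
  intro φ
  refine ⟨fun h => ?_, ?_⟩
  · refine ⟨(LinearMap.ker g).liftQ φ (fun x hx => ?_) ∘ₗ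
      (g.quotKerEquivOfSurjective hg).symm.toLinearMap, ?_⟩
    · obtain ⟨y, rfl⟩ := (hfg x).mp hx
      exact LinearMap.congr_fun h y
    · ext x
      have : (g.quotKerEquivOfSurjective hg).symm (g x) = Submodule.Quotient.mk x := by
        rw [LinearEquiv.symm_apply_eq]
        rfl
      simp [this]
  · rintro ⟨ψ, rfl⟩
    ext x
    simp [hfg.apply_apply_eq_zero]

theorem lcomp_surjective_of_injective (hE : Module.Injective R E) (hf : Function.Injective f) :
    Function.Surjective (LinearMap.lcomp R E f) := fun φ =>
  (hE.out f hf φ).imp fun _ h => LinearMap.ext h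

theorem lcomp_exact_of_injective (hE : Module.Injective R E) (hfg : Function.Exact f g) :
    Function.Exact (LinearMap.lcomp R E g) (LinearMap.lcomp R E f) := by
  have h : Function.Exact f g.rangeRestrict := fun x => by
    rw [← hfg x]
    exact Subtype.ext_iff
  intro φ
  refine ⟨fun h0 => ?_, ?_⟩
  · obtain ⟨ψ, rfl⟩ := (lcomp_exact (L := E) g.surjective_rangeRestrict h φ).mp h0
    obtain ⟨χ, rfl⟩ := lcomp_surjective_of_injective hE (LinearMap.range g).injective_subtype ψ
    exact ⟨χ, rfl⟩
  · rintro ⟨ψ, rfl⟩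
    ext x
    simp [hfg.apply_apply_eq_zero]

theorem surjective_of_lcomp_injective (hc : IsCogenerator R E)
    (h : Function.Injective (LinearMap.lcomp R E f)) : Function.Surjective f := by
  by_contra hf
  obtain ⟨x, hx⟩ := not_forall.mp hf
  obtain ⟨φ, hφ⟩ := hc (M₂ ⧸ LinearMap.range f) ((LinearMap.range f).mkQ x) (by
    simpa [Submodule.Quotient.mk_eq_zero] using hx)
  have : φ ∘ₗ (LinearMap.range f).mkQ = 0 := h (by
    ext y
    have : (LinearMap.range f).mkQ (f y) = 0 := by simp
    simp [this])
  exact hφ (LinearMap.congr_fun this x)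

theorem injective_of_lcomp_surjective (hc : IsCogenerator R E)
    (h : Function.Surjective (LinearMap.lcomp R E f)) : Function.Injective f := by
  rw [injective_iff_map_eq_zero]
  intro x hx
  by_contra hne
  obtain ⟨φ, hφ⟩ := hc M₁ x hne
  obtain ⟨ψ, rfl⟩ := h φ
  simp [hx] at hφ

theorem lcomp_lcomp_surjective_iff (hE : Module.Injective R E) (hc : IsCogenerator R E) :
    Function.Surjective (LinearMap.lcomp R E (LinearMap.lcomp R E f)) ↔ Function.Surjective f :=
  ⟨fun h => surjective_of_lcomp_injective hc (injective_of_lcomp_surjective hc h),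
    fun h => lcomp_surjective_of_injective hE (lcomp_injective_of_surjective h)⟩

theorem IsCogenerator.subsingleton_dual_iff (hc : IsCogenerator R E) {M : Type u}
    [AddCommGroup M] [Module R M] : Subsingleton (M →ₗ[R] E) ↔ Subsingleton M := by
  refine ⟨fun h => subsingleton_of_forall_eq 0 fun x => ?_, fun h => inferInstance⟩
  by_contra hx
  obtain ⟨φ, hφ⟩ := hc M x hx
  exact hφ (by rw [h.elim φ 0]; rfl)

/-- Among the kernels of maps X → E^n choose a minimal one. A nonzero element in it would be
detected by a further map to E, and adjoining that coordinate would shrink the kernel. -/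
theorem IsCogenerator.exists_injective_pi (hc : IsCogenerator R E) (X : Type u) [AddCommGroup X] [Module R X] [IsArtinian R X] :
    ∃ (n : ℕ) (j : X →ₗ[R] Fin n → E), Function.Injective j := by
  obtain ⟨_, ⟨n, j, rfl⟩, hmin⟩ := IsArtinian.set_has_minimal
    {K : Submodule R X | ∃ (n : ℕ) (j : X →ₗ[R] Fin n → E), LinearMap.ker j = K}
    ⟨_, 0, 0, rfl⟩
  refine ⟨n, j, LinearMap.ker_eq_bot.mp ?_⟩
  by_contra hne
  obtain ⟨x, hx, hx0⟩ := Submodule.exists_mem_ne_zero_of_ne_bot hne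
  obtain ⟨φ, hφ⟩ := hc X x hx0
  let j' : X →ₗ[R] Fin (n + 1) → E :=
    LinearMap.pi (Fin.cons φ fun i => LinearMap.proj i ∘ₗ j)
  have hj' (y : X) (hy : j' y = 0) : φ y = 0 ∧ j y = 0 :=
    ⟨congrFun hy 0, funext fun i => congrFun hy i.succ⟩
  refine hmin _ ⟨n + 1, j', rfl⟩ (lt_of_le_of_ne (fun y hy => (hj' y hy).2) fun h => ?_)
  rw [← h] at hx
  exact hφ (hj' x hx).1

/-- The dual of a projective module is injective. -/
theorem injective_dual_of_projective (hE : Module.Injective R E) (F : Type u) [AddCommGroup F]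
    [Module R F] [Module.Projective R F] : Module.Injective R (F →ₗ[R] E) where
  out X Y _ _ _ _ j hj φ := by
    obtain ⟨ψ, hψ⟩ := Module.projective_lifting_property (LinearMap.lcomp R E j) φ.flip
      (lcomp_surjective_of_injective hE hj)
    refine ⟨ψ.flip, fun x => LinearMap.ext fun y => ?_⟩
    exact LinearMap.congr_fun (LinearMap.congr_fun hψ y) x

theorem subsingleton_hom_dual_comm (A B : Type u) [AddCommGroup A] [Module R A]
    [AddCommGroup B] [Module R B] :
    Subsingleton (A →ₗ[R] B →ₗ[R] E) ↔ Subsingleton (B →ₗ[R] A →ₗ[R] E) :=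
  (⟨LinearMap.flip, LinearMap.flip, fun _ => rfl, fun _ => rfl⟩ :
    (A →ₗ[R] B →ₗ[R] E) ≃ (B →ₗ[R] A →ₗ[R] E)).subsingleton_congr

/-- `Ext^i(A, B^∨)` and `Ext^i(B, A^∨)` vanish simultaneously. -/
theorem extVanishes_dual_comm (hE : Module.Injective R E) (A B : Type u) [AddCommGroup A]
    [Module R A] [AddCommGroup B] [Module R B] (i : ℕ) :
    ExtVanishes R A (B →ₗ[R] E) i ↔ ExtVanishes R B (A →ₗ[R] E) i := by
  induction i generalizing A with
  | zero => rw [extVanishes_zero_iff, extVanishes_zero_iff, subsingleton_hom_dual_comm]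
  | succ i ih =>
    obtain ⟨F, _, _, _, q, hq⟩ : ∃ (F : Type u) (_ : AddCommGroup F) (_ : Module R F)
        (_ : Module.Projective R F) (q : F →ₗ[R] A), Function.Surjective q :=
      ⟨A →₀ R, inferInstance, inferInstance, inferInstance, Finsupp.linearCombination R id,
        Finsupp.linearCombination_id_surjective R A⟩
    have hK := (LinearMap.ker q).injective_subtype
    have hex : Function.Exact (LinearMap.ker q).subtype q := LinearMap.exact_subtype_ker_map q
    -- Dualizing 0 → K → F → A → 0 embeds A^∨ in the injective module F^∨ with cokernel K^∨, so the
    -- same K shifts both sides.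
    have hF := injective_dual_of_projective hE F
    have hq' := lcomp_injective_of_surjective (L := E) hq
    have hK' := lcomp_surjective_of_injective (f := (LinearMap.ker q).subtype) hE hK
    have hex' := lcomp_exact (L := E) hq hex
    cases i with
    | zero =>
      rw [extVanishes_one_iff_of_projective hK hq hex,
        extVanishes_one_iff_of_injective hF hq' hK' hex']
      refine ⟨fun h φ => ?_, fun h φ => ?_⟩
      · obtain ⟨ψ, hψ⟩ := h φ.flip
        exact ⟨ψ.flip, congrArg LinearMap.flip hψ⟩
      · obtain ⟨ψ, hψ⟩ := h φ.flip
        exact ⟨ψ.flip, congrArg LinearMap.flip hψ⟩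
    | succ i =>
      rw [extVanishes_add_two_iff_of_projective hK hq hex,
        extVanishes_add_two_iff_of_injective hF hq' hK' hex', ih]

/-! ### Double duals of Hom modules -/

section DoubleDual

variable (R E) (N : Type u) [AddCommGroup N] [Module R N]

/-- The canonical map `Hom(P, N)^∨∨ → Hom(N^∨, P^∨)`. -/
def homDoubleDualMap (P : Type u) [AddCommGroup P] [Module R P] :
    (((P →ₗ[R] N) →ₗ[R] E) →ₗ[R] E) →ₗ[R] (N →ₗ[R] E) →ₗ[R] P →ₗ[R] E where
  toFun α := LinearMap.mk₂ R (fun φ p => α (φ ∘ₗ LinearMap.applyₗ p))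
    (fun φ ψ p => by rw [LinearMap.add_comp, map_add])
    (fun c φ p => by rw [LinearMap.smul_comp, map_smul])
    (fun φ p q => by rw [map_add, LinearMap.comp_add, map_add])
    (fun c φ p => by rw [map_smul, LinearMap.comp_smul, map_smul])
  map_add' _ _ := rfl
  map_smul' _ _ := rfl

variable {R E N}

theorem homDoubleDualMap_apply {P : Type u} [AddCommGroup P] [Module R P]
    (α : ((P →ₗ[R] N) →ₗ[R] E) →ₗ[R] E) (φ : N →ₗ[R] E) (p : P) :
    homDoubleDualMap R E N P α φ p = α (φ ∘ₗ LinearMap.applyₗ p) := rfl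

theorem homDoubleDualMap_naturality {P Q : Type u} [AddCommGroup P] [Module R P]
    [AddCommGroup Q] [Module R Q] (f : P →ₗ[R] Q) (α : ((Q →ₗ[R] N) →ₗ[R] E) →ₗ[R] E) :
    homDoubleDualMap R E N P
        (LinearMap.lcomp R E (LinearMap.lcomp R E (LinearMap.lcomp R N f)) α) =
      LinearMap.lcomp R E f ∘ₗ homDoubleDualMap R E N Q α := rfl

/-- The map `n ↦ (p ↦ p i • n)`. -/
def coordSMul (R : Type u) [CommRing R] (N : Type u) [AddCommGroup N] [Module R N] {n : ℕ}
    (i : Fin n) : N →ₗ[R] (Fin n → R) →ₗ[R] N :=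
  LinearMap.lcomp R N (LinearMap.proj i) ∘ₗ (LinearMap.lsmul R N).flip

theorem coordSMul_apply {n : ℕ} (i : Fin n) (x : N) (p : Fin n → R) :
    coordSMul R N i x p = p i • x := rfl

theorem sum_coordSMul {n : ℕ} (f : (Fin n → R) →ₗ[R] N) :
    ∑ i, coordSMul R N i (f (Pi.single i 1)) = f := by
  ext j
  simp [coordSMul_apply, Pi.single_apply]

/-- Hom(R^n, N) is N^n, so every functional on it is a sum of functionals on N composed with
evaluation at the basis vectors. This determines α from its image, and gives the formula for the
preimage. -/
theorem homDoubleDualMap_bijective_of_free (n : ℕ) :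
    Function.Bijective (homDoubleDualMap R E N (Fin n → R)) := by
  constructor
  · rw [injective_iff_map_eq_zero]
    intro α hα
    ext γ
    have hγ : γ = ∑ i, (γ ∘ₗ coordSMul R N i) ∘ₗ LinearMap.applyₗ (Pi.single i (1 : R)) := by
      ext f
      conv_lhs => rw [← sum_coordSMul f]
      simp
    rw [hγ, map_sum]
    exact Finset.sum_eq_zero fun i _ =>
      LinearMap.congr_fun (LinearMap.congr_fun hα (γ ∘ₗ coordSMul R N i)) (Pi.single i 1)
  · intro β
    refine ⟨∑ i, LinearMap.applyₗ (Pi.single i (1 : R)) ∘ₗ β ∘ₗ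
      LinearMap.lcomp R E (coordSMul R N i), ?_⟩
    ext φ j
    have h (i : Fin n) : (φ ∘ₗ LinearMap.applyₗ (Pi.single j (1 : R))) ∘ₗ coordSMul R N i =
        (Pi.single j 1 : Fin n → R) i • φ := by
      ext x
      simp [coordSMul_apply]
    have h' (i : Fin n) : LinearMap.lcomp R E (coordSMul R N i)
        (φ ∘ₗ LinearMap.applyₗ (Pi.single j (1 : R))) = (Pi.single j 1 : Fin n → R) i • φ := h i
    simp only [homDoubleDualMap_apply, LinearMap.sum_apply, LinearMap.coe_comp,
      Function.comp_apply, h', LinearMap.applyₗ_apply_apply, map_smul,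
      LinearMap.coe_single]
    rw [Finset.sum_eq_single j (fun i _ hi => by simp [hi]) (by simp)]
    simp

theorem homDoubleDualMap_injective (hE : Module.Injective R E) (P : Type u) [AddCommGroup P]
    [Module R P] [Module.Finite R P] : Function.Injective (homDoubleDualMap R E N P) := by
  obtain ⟨n, q, hq⟩ := Module.Finite.exists_fin' R P
  intro α β h
  refine lcomp_injective_of_surjective (lcomp_surjective_of_injective hE
    (lcomp_injective_of_surjective (L := N) hq)) ?_
  refine (homDoubleDualMap_bijective_of_free n).1 ?_
  rw [homDoubleDualMap_naturality, homDoubleDualMap_naturality, h]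

/-- Both sides are contravariant left exact functors of P. Present P as a quotient of R^n:
surjectivity follows from bijectivity for R^n together with injectivity for the kernel, which is
finitely generated as R is noetherian. -/
theorem homDoubleDualMap_bijective [IsNoetherianRing R] (hE : Module.Injective R E) (P : Type u)
    [AddCommGroup P] [Module R P] [Module.Finite R P] :
    Function.Bijective (homDoubleDualMap R E N P) := by
  refine ⟨homDoubleDualMap_injective hE P, fun β => ?_⟩
  obtain ⟨n, q, hq⟩ := Module.Finite.exists_fin' R P
  obtain ⟨α, hα⟩ := (homDoubleDualMap_bijective_of_free n).2 (LinearMap.lcomp R E q ∘ₗ β)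
  have hex : Function.Exact (LinearMap.ker q).subtype q := LinearMap.exact_subtype_ker_map q
  have h0 : LinearMap.lcomp R E (LinearMap.lcomp R E
      (LinearMap.lcomp R N (LinearMap.ker q).subtype)) α = 0 := by
    refine homDoubleDualMap_injective hE (LinearMap.ker q) ?_
    rw [homDoubleDualMap_naturality, hα, map_zero]
    ext φ x
    simp
  obtain ⟨γ, rfl⟩ := (lcomp_exact_of_injective hE (lcomp_exact_of_injective hE
    (lcomp_exact (L := N) hq hex)) α).mp h0
  refine ⟨γ, ?_⟩
  rw [homDoubleDualMap_naturality] at hα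
  ext φ : 1
  exact lcomp_injective_of_surjective hq (LinearMap.congr_fun hα φ)

/-- For `P` finitely generated over a noetherian ring, `Ext^i(N^∨, P^∨)` and `Ext^i(P, N)` vanish
simultaneously. -/
theorem extVanishes_dual_dual_iff [IsNoetherianRing R] (hE : Module.Injective R E)
    (hc : IsCogenerator R E) (P : Type u) [AddCommGroup P] [Module R P] [Module.Finite R P]
    (i : ℕ) :
    ExtVanishes R (N →ₗ[R] E) (P →ₗ[R] E) i ↔ ExtVanishes R P N i := by
  induction i generalizing P with
  | zero =>
    rw [extVanishes_zero_iff, extVanishes_zero_iff,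
      ← (Equiv.ofBijective _ (homDoubleDualMap_bijective (N := N) hE P)).subsingleton_congr,
      hc.subsingleton_dual_iff, hc.subsingleton_dual_iff]
  | succ i ih =>
    obtain ⟨n, q, hq⟩ := Module.Finite.exists_fin' R P
    have hK := (LinearMap.ker q).injective_subtype
    have hex : Function.Exact (LinearMap.ker q).subtype q := LinearMap.exact_subtype_ker_map q
    have hF := injective_dual_of_projective hE (Fin n → R)
    have hq' := lcomp_injective_of_surjective (L := E) hq
    have hK' := lcomp_surjective_of_injective (f := (LinearMap.ker q).subtype) hE hK
    have hex' := lcomp_exact (L := E) hq hex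
    cases i with
    | zero =>
      have hΘF := homDoubleDualMap_bijective (N := N) hE (Fin n → R)
      have hΘK := homDoubleDualMap_bijective (N := N) hE (LinearMap.ker q)
      -- Restriction Hom(F, N) → Hom(K, N) is surjective exactly when its double dual is. The
      -- natural bijections identify the double dual with Hom(N^∨, F^∨) → Hom(N^∨, K^∨); the square
      -- commutes by definition.
      rw [extVanishes_one_iff_of_projective hK hq hex,
        extVanishes_one_iff_of_injective hF hq' hK' hex',
        ← lcomp_lcomp_surjective_iff (f := LinearMap.lcomp R N (LinearMap.ker q).subtype) hE hc,
        ← Function.Surjective.of_comp_iff _ hΘF.2, ← Function.Surjective.of_comp_iff' hΘK]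
      rfl
    | succ i =>
      rw [extVanishes_add_two_iff_of_projective hK hq hex,
        extVanishes_add_two_iff_of_injective hF hq' hK' hex', ih]

end DoubleDual

end Dual

/-! ## Completions of noetherian rings are noetherian -/

section Completion

variable {Q R : Type u} [CommRing Q] [CommRing R]

/-- The map from the `J`-adic completion to `R / I ^ n` that is induced by `φ`, where
`φ(J) ⊆ I`. -/
noncomputable def adicCompletionQuotientMap (φ : Q →+* R) (J : Ideal Q) (I : Ideal R)
    (h : J.map φ ≤ I) (n : ℕ) : AdicCompletion J Q →+* R ⧸ I ^ n :=
  (Ideal.quotientMap (I ^ n) φ (Ideal.map_le_iff_le_comap.mp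
    (by rw [Ideal.map_pow]; exact Ideal.pow_right_mono h n))).comp
      (AdicCompletion.evalₐ J n : AdicCompletion J Q →+* Q ⧸ J ^ n)

theorem adicCompletionQuotientMap_mk (φ : Q →+* R) (J : Ideal Q) (I : Ideal R)
    (h : J.map φ ≤ I) (n : ℕ) (f : AdicCompletion.AdicCauchySequence J Q) :
    adicCompletionQuotientMap φ J I h n (AdicCompletion.mk J Q f) =
      Ideal.Quotient.mk (I ^ n) (φ (f n)) := by
  rw [adicCompletionQuotientMap, RingHom.comp_apply, RingHom.coe_coe, AdicCompletion.evalₐ_mk,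
    Ideal.quotientMap_mk]

theorem factorPow_comp_adicCompletionQuotientMap (φ : Q →+* R) (J : Ideal Q) (I : Ideal R)
    (h : J.map φ ≤ I) {m n : ℕ} (hle : m ≤ n) :
    (Ideal.Quotient.factorPow I hle).comp (adicCompletionQuotientMap φ J I h n) =
      adicCompletionQuotientMap φ J I h m := by
  refine RingHom.ext fun x => ?_
  induction x using AdicCompletion.induction_on with
  | _ f =>
    have h2 := AdicCompletion.AdicCauchySequence.mk_eq_mk hle f
    rw [Submodule.Quotient.eq] at h2
    rw [RingHom.comp_apply, adicCompletionQuotientMap_mk, adicCompletionQuotientMap_mk]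
    change Ideal.Quotient.mk (I ^ m) (φ (f n)) = Ideal.Quotient.mk (I ^ m) (φ (f m))
    rw [Ideal.Quotient.eq, ← map_sub]
    refine Ideal.pow_right_mono h m ?_
    rw [← Ideal.map_pow]
    exact Ideal.mem_map_of_mem φ (by simpa using h2)

/-- The ring homomorphism between completions that is induced by `φ`, where `φ(J) ⊆ I`. -/
noncomputable def adicCompletionMap (φ : Q →+* R) (J : Ideal Q) (I : Ideal R)
    (h : J.map φ ≤ I) : AdicCompletion J Q →+* AdicCompletion I R :=
  AdicCompletion.liftRingHom I (adicCompletionQuotientMap φ J I h)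
    (factorPow_comp_adicCompletionQuotientMap φ J I h)

theorem evalₐ_adicCompletionMap (φ : Q →+* R) (J : Ideal Q) (I : Ideal R)
    (h : J.map φ ≤ I) (n : ℕ) (f : AdicCompletion.AdicCauchySequence J Q) :
    AdicCompletion.evalₐ I n (adicCompletionMap φ J I h (AdicCompletion.mk J Q f)) =
      Ideal.Quotient.mk (I ^ n) (φ (f n)) :=
  (AdicCompletion.evalₐ_liftRingHom I _ (factorPow_comp_adicCompletionQuotientMap φ J I h)
    n _).trans (adicCompletionQuotientMap_mk φ J I h n f)

/-- A Cauchy sequence is lifted term by term: successive terms differ by an element of I^n = φ(J^n),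
so the next lift can be chosen to differ from the previous one by an element of J^n. -/
theorem adicCompletionMap_surjective {φ : Q →+* R} (hφ : Function.Surjective φ) (J : Ideal Q)
    (I : Ideal R) (h : J.map φ = I) : Function.Surjective (adicCompletionMap φ J I h.le) := by
  intro s
  induction s using AdicCompletion.induction_on with
  | _ f =>
    have step (n : ℕ) (q : {q : Q // φ q = f n}) :
        ∃ q' : {q : Q // φ q = f (n + 1)}, (q' : Q) - q ∈ J ^ n := by
      have h2 := AdicCompletion.AdicCauchySequence.mk_eq_mk n.le_succ f
      rw [Submodule.Quotient.eq] at h2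
      have h3 : f (n + 1) - f n ∈ (J ^ n).map φ := by
        rw [Ideal.map_pow, h]
        simpa using h2
      obtain ⟨t, ht, hft⟩ := (Ideal.mem_map_iff_of_surjective φ hφ).mp h3
      exact ⟨⟨q + t, by rw [map_add, q.2, hft, add_sub_cancel]⟩, by simpa using ht⟩
    choose nxt hnxt using step
    let g : ∀ n, {q : Q // φ q = f n} := fun n =>
      Nat.rec ⟨(hφ (f 0)).choose, (hφ (f 0)).choose_spec⟩ nxt n
    refine ⟨AdicCompletion.mk J Q (AdicCompletion.AdicCauchySequence.mk J Q (fun n => (g n).1)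
      fun n => ?_), AdicCompletion.ext_evalₐ fun n => ?_⟩
    · rw [SModEq.comm, SModEq.sub_mem]
      simpa using hnxt n (g n)
    · rw [evalₐ_adicCompletionMap, AdicCompletion.evalₐ_mk]
      exact congrArg _ (g n).2

/-- Sending variables to generators of I makes R a quotient of a polynomial ring over R. Completing
at the ideal of the variables exhibits the completion as a quotient of a power series ring over R,
which is noetherian. -/
theorem isNoetherianRing_adicCompletion [IsNoetherianRing R] (I : Ideal R) :
    IsNoetherianRing (AdicCompletion I R) := by
  obtain ⟨n, a, ha⟩ := Submodule.fg_iff_exists_fin_generating_family.mp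
    (IsNoetherian.noetherian I)
  let φ : MvPolynomial (Fin n) R →+* R := (MvPolynomial.aeval a : _ →ₐ[R] R)
  have hφ : Function.Surjective φ := fun r => ⟨MvPolynomial.C r, by simp [φ]⟩
  have h : (MvPolynomial.idealOfVars (Fin n) R).map φ = I := by
    rw [MvPolynomial.idealOfVars, Ideal.map_span, ← ha]
    refine congrArg Ideal.span ?_
    rw [← Set.range_comp]
    exact congrArg Set.range (funext fun i => by simp [φ])
  have h1 : IsNoetherianRing (AdicCompletion (MvPolynomial.idealOfVars (Fin n) R)
      (MvPolynomial (Fin n) R)) :=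
    isNoetherianRing_of_ringEquiv _
      (MvPowerSeries.toAdicCompletionAlgEquiv (Fin n) R).toRingEquiv
  exact isNoetherianRing_of_surjective _ _ _ (adicCompletionMap_surjective hφ _ I h)

end Completion

/-! ## The injective hull of the residue field -/

section Hull

variable {R : Type u} [CommRing R] [IsLocalRing R] {E : Type u} [AddCommGroup E] [Module R E]
  {ι : IsLocalRing.ResidueField R →ₗ[R] E}

theorem maximalIdeal_smul_residueField (a : R) (ha : a ∈ IsLocalRing.maximalIdeal R)
    (x : IsLocalRing.ResidueField R) : a • x = 0 := by
  rw [Algebra.smul_def, IsLocalRing.ResidueField.algebraMap_eq,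
    (IsLocalRing.residue_eq_zero_iff a).mpr ha, zero_mul]

/-- Apply Artin–Rees to T = Rx and S = T ∩ ι(k). For large n, 𝔪^(n+1)T ∩ S ⊆ 𝔪S = 0, so 𝔪^(n+1)T = 0
by essentiality. -/
theorem IsInjectiveHull.isAdicTorsion [IsNoetherianRing R] (hE : IsInjectiveHull ι) :
    IsAdicTorsion (IsLocalRing.maximalIdeal R) E := by
  intro x
  set m := IsLocalRing.maximalIdeal R
  let T : Submodule R E := Submodule.span R {x}
  obtain ⟨k, hk⟩ := m.exists_pow_inf_eq_pow_smul ((LinearMap.range ι).comap T.subtype)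
  refine ⟨k + 1, fun a ha => ?_⟩
  have h0 : (m ^ (k + 1) • ⊤ : Submodule R T).map T.subtype = ⊥ := by
    refine hE.essential _ ((Submodule.eq_bot_iff _).mpr ?_)
    rintro _ ⟨⟨t, ht, rfl⟩, hx⟩
    have h1 : t ∈ m ^ (k + 1) • ⊤ ⊓ (LinearMap.range ι).comap T.subtype := ⟨ht, hx⟩
    rw [hk (k + 1) k.le_succ, Nat.add_sub_cancel_left, pow_one] at h1
    have h2 : m • (m ^ k • ⊤ ⊓ (LinearMap.range ι).comap T.subtype) ≤ (⊥ : Submodule R T) := by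
      refine Submodule.smul_le.mpr fun b hb y hy => ?_
      obtain ⟨c, hc⟩ := hy.2
      refine (Submodule.mem_bot R).mpr (Subtype.ext ?_)
      change b • T.subtype y = 0
      rw [← hc, ← map_smul, maximalIdeal_smul_residueField b hb, map_zero]
    rw [(Submodule.mem_bot R).mp (h2 h1), map_zero]
  refine (Submodule.eq_bot_iff _).mp h0 _
    ⟨a • ⟨x, Submodule.mem_span_singleton_self x⟩, Submodule.smul_mem_smul ha trivial, rfl⟩

/-- By essentiality some nonzero multiple c • e lies in the image of the residue field, and c is a
unit because 𝔪 kills e. -/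
theorem IsInjectiveHull.mem_range_of_smul_eq_zero (hE : IsInjectiveHull ι) (e : E)
    (he : ∀ a ∈ IsLocalRing.maximalIdeal R, a • e = 0) : e ∈ LinearMap.range ι := by
  by_cases h0 : e = 0
  · exact h0 ▸ zero_mem _
  have h1 : Submodule.span R {e} ⊓ LinearMap.range ι ≠ ⊥ := fun h =>
    h0 (Submodule.span_singleton_eq_bot.mp (hE.essential _ h))
  obtain ⟨y, ⟨hy, hyι⟩, hy0⟩ := Submodule.exists_mem_ne_zero_of_ne_bot h1
  obtain ⟨c, rfl⟩ := Submodule.mem_span_singleton.mp hy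
  have hc : IsUnit c := by
    by_contra hc
    exact hy0 (he c ((IsLocalRing.mem_maximalIdeal c).mpr hc))
  obtain ⟨c, rfl⟩ := hc
  have := (LinearMap.range ι).smul_mem ((c⁻¹ : Rˣ) : R) hyι
  rwa [smul_smul, Units.inv_mul, one_smul] at this

/-- The socle of the injective hull of the residue field is one-dimensional. -/
theorem IsInjectiveHull.exists_smul_eq (hE : IsInjectiveHull ι) (e e' : E) (h0 : e ≠ 0)
    (he : ∀ a ∈ IsLocalRing.maximalIdeal R, a • e = 0)
    (he' : ∀ a ∈ IsLocalRing.maximalIdeal R, a • e' = 0) : ∃ r : R, e' = r • e := by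
  obtain ⟨s, rfl⟩ := hE.mem_range_of_smul_eq_zero e he
  obtain ⟨t, rfl⟩ := hE.mem_range_of_smul_eq_zero e' he'
  have hs : s ≠ 0 := by
    rintro rfl
    exact h0 (map_zero ι)
  obtain ⟨r, hr⟩ := IsLocalRing.residue_surjective (t / s)
  refine ⟨r, ?_⟩
  rw [← map_smul, Algebra.smul_def, IsLocalRing.ResidueField.algebraMap_eq, hr,
    div_mul_cancel₀ _ hs]

theorem IsSimpleModule.maximalIdeal_smul {M : Type u} [AddCommGroup M] [Module R M]
    [IsSimpleModule R M] (a : R) (ha : a ∈ IsLocalRing.maximalIdeal R) (x : M) : a • x = 0 := by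
  have := IsLocalRing.eq_maximalIdeal (IsSimpleModule.annihilator_isMaximal (R := R) (M := M))
  exact Module.mem_annihilator.mp (this.symm ▸ ha) x

/-- Modules of finite length are reflexive (surjectivity part). -/
theorem IsInjectiveHull.exists_eval_eq (hE : IsInjectiveHull ι) {M : Type u} [AddCommGroup M]
    [Module R M] (hM : IsFiniteLength R M) (α : (M →ₗ[R] E) →ₗ[R] E) :
    ∃ x : M, ∀ φ, α φ = φ x := by
  induction hM with
  | of_subsingleton => exact ⟨0, fun φ => by rw [Subsingleton.elim φ 0, map_zero]; rfl⟩
  | @of_simple_quotient M _ _ N hN _ ih =>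
    -- Reflexivity of the simple quotient: all values of functionals lie in the one-dimensional
    -- socle of E, so its dual is spanned by one φ₀.
    obtain ⟨y, hy⟩ : ∃ y : M ⧸ N, ∀ φ : M ⧸ N →ₗ[R] E, α (φ ∘ₗ N.mkQ) = φ y := by
      have := IsSimpleModule.nontrivial R (M ⧸ N)
      obtain ⟨z, hz⟩ := exists_ne (0 : M ⧸ N)
      obtain ⟨φ₀, hφ₀⟩ := hE.isCogenerator (M ⧸ N) z hz
      have hk (φ : M ⧸ N →ₗ[R] E) (a : R) (ha : a ∈ IsLocalRing.maximalIdeal R) : a • φ = 0 := by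
        ext x
        change a • φ (N.mkQ x) = 0
        rw [← map_smul, IsSimpleModule.maximalIdeal_smul a ha, map_zero]
      obtain ⟨r, hr⟩ := hE.exists_smul_eq (φ₀ z) (α (φ₀ ∘ₗ N.mkQ)) hφ₀
        (fun a ha => LinearMap.congr_fun (hk φ₀ a ha) z)
        (fun a ha => by rw [← map_smul, ← LinearMap.smul_comp, hk φ₀ a ha]; simp)
      refine ⟨r • z, fun φ => ?_⟩
      obtain ⟨c, hc⟩ := hE.exists_smul_eq (φ₀ z) (φ z) hφ₀
        (fun a ha => LinearMap.congr_fun (hk φ₀ a ha) z)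
        (fun a ha => LinearMap.congr_fun (hk φ a ha) z)
      have : φ = c • φ₀ := by
        refine LinearMap.ext fun w => ?_
        obtain ⟨b, rfl⟩ := (IsSimpleModule.toSpanSingleton_surjective R hz) w
        simp only [LinearMap.toSpanSingleton_apply, map_smul, hc, LinearMap.smul_apply]
      rw [this, LinearMap.smul_comp, map_smul, hr, LinearMap.smul_apply, map_smul]
    obtain ⟨y, rfl⟩ := N.mkQ_surjective y
    -- After subtracting evaluation at y, α vanishes on (M/N)^∨ and hence comes from N^∨∨, where
    -- induction applies.
    obtain ⟨β, hβ⟩ := (lcomp_exact (L := E)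
      (lcomp_surjective_of_injective hE.injective_module N.injective_subtype)
      (lcomp_exact (L := E) N.mkQ_surjective (LinearMap.exact_subtype_mkQ N))
      (α - LinearMap.applyₗ y)).mp (by
        ext φ
        exact sub_eq_zero.mpr (hy φ))
    obtain ⟨x, hx⟩ := ih β
    refine ⟨x + y, fun φ => ?_⟩
    have h1 : β (φ ∘ₗ N.subtype) = α φ - φ y := LinearMap.congr_fun hβ φ
    rw [map_add, ← sub_eq_iff_eq_add, ← h1, hx]
    rfl

theorem isFiniteLength_quotient_maximalIdeal_pow [IsNoetherianRing R] (n : ℕ) :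
    IsFiniteLength R (R ⧸ IsLocalRing.maximalIdeal R ^ n) := by
  rcases Nat.eq_zero_or_pos n with rfl | hn
  · have : Subsingleton (R ⧸ IsLocalRing.maximalIdeal R ^ 0) :=
      Ideal.Quotient.subsingleton_iff.mpr (by simp)
    exact IsFiniteLength.of_subsingleton
  · have : IsArtinianRing (R ⧸ IsLocalRing.maximalIdeal R ^ n) :=
      IsLocalRing.quotient_artinian_of_mem_minimalPrimes_of_isLocalRing _
        ⟨⟨inferInstance, Ideal.pow_le_self hn.ne'⟩,
          fun q hq _ => hq.1.le_of_pow_le hq.2⟩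
    exact isFiniteLength_iff_isNoetherian_isArtinian.mpr ⟨inferInstance,
      isArtinian_of_surjective_algebraMap
        (Ideal.Quotient.mk_surjective (I := IsLocalRing.maximalIdeal R ^ n))⟩

/-- An endomorphism of the injective hull of the residue field is, on the elements killed by
`𝔪 ^ n`, multiplication by an element of `R`. -/
theorem IsInjectiveHull.exists_smul_eq_of_pow [IsNoetherianRing R] (hE : IsInjectiveHull ι)
    (f : E →ₗ[R] E) (n : ℕ) :
    ∃ r : R, ∀ e : E, (∀ a ∈ IsLocalRing.maximalIdeal R ^ n, a • e = 0) → f e = r • e := by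
  let one : R ⧸ IsLocalRing.maximalIdeal R ^ n := Submodule.Quotient.mk 1
  -- Hom(R/𝔪^n, E) is the 𝔪^n-torsion of E through evaluation at 1, so f restricted to that torsion
  -- is an element of (R/𝔪^n)^∨∨.
  obtain ⟨x, hx⟩ := hE.exists_eval_eq (isFiniteLength_quotient_maximalIdeal_pow n)
    (f ∘ₗ LinearMap.applyₗ one)
  obtain ⟨r, rfl⟩ := Submodule.Quotient.mk_surjective _ x
  refine ⟨r, fun e he => ?_⟩
  have h := hx (Submodule.liftQ _ (LinearMap.toSpanSingleton R E e) he)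
  change f ((1 : R) • e) = r • e at h
  rwa [one_smul] at h

/-- The 𝔪^n-torsion of E is faithful over R/𝔪^n, because E cogenerates R/𝔪^n. -/
theorem IsInjectiveHull.mem_pow_of_forall_smul_eq_zero (hE : IsInjectiveHull ι) (n : ℕ) (r : R)
    (hr : ∀ e : E, (∀ a ∈ IsLocalRing.maximalIdeal R ^ n, a • e = 0) → r • e = 0) :
    r ∈ IsLocalRing.maximalIdeal R ^ n := by
  by_contra hne
  obtain ⟨φ, hφ⟩ := hE.isCogenerator (R ⧸ IsLocalRing.maximalIdeal R ^ n)
    (Submodule.Quotient.mk r) (by rwa [ne_eq, Submodule.Quotient.mk_eq_zero])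
  have h1 (a : R) : φ (Submodule.Quotient.mk a) = a • φ (Submodule.Quotient.mk 1) := by
    rw [← map_smul, ← Submodule.Quotient.mk_smul, smul_eq_mul, mul_one]
  refine hφ ((h1 r).trans (hr _ fun a ha => ?_))
  rw [← h1, (Submodule.Quotient.mk_eq_zero _).mpr ha, map_zero]

end Hull

/-! ### Duals of torsion modules over the completion -/

section TorsionDual

variable {R : Type u} [CommRing R] {I : Ideal R}

theorem map_torsionSMul {X Y : Type u} [AddCommGroup X] [Module R X] [AddCommGroup Y] [Module R Y]
    (hX : IsAdicTorsion I X) (hY : IsAdicTorsion I Y) (f : X →ₗ[R] Y) (s : AdicCompletion I R)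
    (x : X) : f (torsionSMul hX s x) = torsionSMul hY s (f x) := by
  obtain ⟨n, hn⟩ := hX x
  obtain ⟨s₀, hs⟩ := Ideal.Quotient.mk_surjective (AdicCompletion.evalₐ I n s)
  rw [torsionSMul_eq hX s x n hn s₀ hs.symm, map_smul, torsionSMul_eq hY s (f x) n
    (fun a ha => by rw [← map_smul, hn a ha, map_zero]) s₀ hs.symm]

theorem torsionSMul_zero_right {I : Ideal R} {L : Type u} [AddCommGroup L] [Module R L]
    (hL : IsAdicTorsion I L) (s : AdicCompletion I R) : torsionSMul hL s 0 = 0 :=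
  (torsionModule hL).smul_zero s

theorem IsAdicTorsion.pi {L : Type u} [AddCommGroup L] [Module R L] (hL : IsAdicTorsion I L)
    (n : ℕ) : IsAdicTorsion I (Fin n → L) := by
  intro v
  choose k hk using fun i => hL (v i)
  refine ⟨Finset.univ.sup k, fun a ha => funext fun i => hk i a ?_⟩
  exact Ideal.pow_le_pow_right (Finset.le_sup (Finset.mem_univ i)) ha

/-- `Hom_R(L, E)`, for an `I`-torsion module `L`, as a module over the completion. -/
def TorsionDual {L : Type u} [AddCommGroup L] [Module R L] (_ : IsAdicTorsion I L) (E : Type u)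
    [AddCommGroup E] [Module R E] : Type u := L →ₗ[R] E

variable {E : Type u} [AddCommGroup E] [Module R E] {X Y Z : Type u} [AddCommGroup X]
  [Module R X] [AddCommGroup Y] [Module R Y] [AddCommGroup Z] [Module R Z]
  (hX : IsAdicTorsion I X) (hY : IsAdicTorsion I Y)

noncomputable instance : AddCommGroup (TorsionDual hX E) :=
  inferInstanceAs (AddCommGroup (X →ₗ[R] E))

noncomputable instance : Module (AdicCompletion I R) (TorsionDual hX E) :=
  torsionDualModule hX E

variable {hX hY}

/-- The underlying `R`-linear map of an element of `TorsionDual hX E`. -/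
def TorsionDual.hom (φ : TorsionDual hX E) : X →ₗ[R] E := φ

variable (hX) in
/-- An `R`-linear map to `E` as an element of `TorsionDual hX E`. -/
def TorsionDual.ofHom (φ : X →ₗ[R] E) : TorsionDual hX E := φ

theorem TorsionDual.ext {φ ψ : TorsionDual hX E} (h : ∀ x, φ.hom x = ψ.hom x) : φ = ψ :=
  LinearMap.ext h

theorem TorsionDual.smul_hom_apply (s : AdicCompletion I R) (φ : TorsionDual hX E) (x : X) :
    (s • φ).hom x = φ.hom (torsionSMul hX s x) := rfl

theorem TorsionDual.sum_hom_apply {n : ℕ} (φ : Fin n → TorsionDual hX E) (x : X) :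
    (∑ i, φ i).hom x = ∑ i, (φ i).hom x :=
  LinearMap.sum_apply (Finset.univ : Finset (Fin n)) (fun i => (φ i).hom) x

variable (hX hY)

/-- The dual of an `R`-linear map between torsion modules is linear over the completion. -/
noncomputable def torsionDualMap (f : X →ₗ[R] Y) :
    TorsionDual hY E →ₗ[AdicCompletion I R] TorsionDual hX E where
  toFun φ := LinearMap.lcomp R E f φ.hom
  map_add' φ ψ := map_add (LinearMap.lcomp R E f) φ.hom ψ.hom
  map_smul' s φ := TorsionDual.ext fun x => by
    change φ.hom (torsionSMul hY s (f x)) = φ.hom (f (torsionSMul hX s x))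
    rw [map_torsionSMul hX hY]

theorem torsionDualMap_injective (hc : IsCogenerator R E) :
    Function.Injective (torsionDualMap (E := E) hX hY) := by
  intro f g hfg
  ext a
  by_contra hne
  obtain ⟨φ, hφ⟩ := hc Y (f a - g a) (sub_ne_zero.mpr hne)
  refine hφ ?_
  rw [map_sub, sub_eq_zero]
  exact congrArg (fun ψ : TorsionDual hX E => ψ.hom a)
    (LinearMap.congr_fun hfg (TorsionDual.ofHom hY φ))

/-- A nonzero s x is detected by a functional on X, so dualizing does not enlarge the annihilator.
-/
theorem annihilator_torsionDual (hc : IsCogenerator R E) :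
    Module.annihilator (AdicCompletion I R) (TorsionDual hX E) =
      letI := torsionModule hX
      Module.annihilator (AdicCompletion I R) X := by
  ext s
  rw [Module.mem_annihilator, @Module.mem_annihilator _ _ _ _ (torsionModule hX)]
  change _ ↔ ∀ x, torsionSMul hX s x = 0
  refine ⟨fun h x => ?_, fun h φ => TorsionDual.ext fun x => ?_⟩
  · by_contra hne
    obtain ⟨φ, hφ⟩ := hc X _ hne
    exact hφ (congrArg (fun ψ : TorsionDual hX E => ψ.hom x) (h φ))
  · rw [TorsionDual.smul_hom_apply, h, map_zero]
    rfl

end TorsionDual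

/-! ## Matlis duality for artinian modules -/

section Matlis

variable {R : Type u} [CommRing R] [IsLocalRing R] {E : Type u}
  [AddCommGroup E] [Module R E] {ι : IsLocalRing.ResidueField R →ₗ[R] E}

local notation "Rhat" => AdicCompletion (IsLocalRing.maximalIdeal R) R

theorem IsInjectiveHull.eq_zero_of_torsionSMul (hE : IsInjectiveHull ι)
    (hT : IsAdicTorsion (IsLocalRing.maximalIdeal R) E) (s : Rhat)
    (hs : ∀ e, torsionSMul hT s e = 0) : s = 0 := by
  refine AdicCompletion.ext_evalₐ fun n => ?_
  obtain ⟨r, hr⟩ := Ideal.Quotient.mk_surjective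
    (AdicCompletion.evalₐ (IsLocalRing.maximalIdeal R) n s)
  rw [map_zero, ← hr, Ideal.Quotient.eq_zero_iff_mem]
  refine hE.mem_pow_of_forall_smul_eq_zero n r fun e he => ?_
  rw [← torsionSMul_eq hT s e n he r hr.symm, hs]

/-- Every endomorphism of the injective hull of the residue field is multiplication by an element
of the completion. -/
theorem IsInjectiveHull.exists_torsionSMul_eq [IsNoetherianRing R] (hE : IsInjectiveHull ι)
    (hT : IsAdicTorsion (IsLocalRing.maximalIdeal R) E) (f : E →ₗ[R] E) :
    ∃ s : Rhat, ∀ e, f e = torsionSMul hT s e := by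
  choose r hr using hE.exists_smul_eq_of_pow f
  refine ⟨AdicCompletion.mk _ R (AdicCompletion.AdicCauchySequence.mk _ R r fun n => ?_),
    fun e => ?_⟩
  -- Both r n and r (n + 1) act as f on the 𝔪^n-torsion of E, which is faithful modulo 𝔪^n; hence
  -- they agree modulo 𝔪^n.
  · rw [SModEq.sub_mem, smul_eq_mul, Ideal.mul_top]
    refine hE.mem_pow_of_forall_smul_eq_zero n _ fun e he => ?_
    rw [sub_smul, ← hr n e he, ← hr (n + 1) e fun a ha =>
      he a (Ideal.pow_le_pow_right n.le_succ ha), sub_self]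
  · obtain ⟨n, hn⟩ := hT e
    rw [torsionSMul_eq hT _ e n hn (r n) (AdicCompletion.evalₐ_mk _ _ _), hr n e hn]

/-- The annihilator in the completion of a submodule of a torsion module. -/
noncomputable def torsionAnnihilator {I : Ideal R} {L : Type u} [AddCommGroup L] [Module R L]
    (hL : IsAdicTorsion I L) (X : Submodule R L) : Ideal (AdicCompletion I R) where
  carrier := {s | ∀ x ∈ X, torsionSMul hL s x = 0}
  zero_mem' x _ := (torsionModule hL).zero_smul x
  add_mem' {s t} hs ht x hx := by
    refine ((torsionModule hL).add_smul s t x).trans ?_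
    exact (congrArg₂ (· + ·) (hs x hx) (ht x hx)).trans (add_zero 0)
  smul_mem' s t ht x hx := by
    refine ((torsionModule hL).mul_smul s t x).trans ?_
    exact (congrArg (torsionSMul hL s) (ht x hx)).trans ((torsionModule hL).smul_zero s)

/-- If e ∉ X, some map E/X → E detects e. Composed with E → E/X it is an endomorphism of E, hence
multiplication by an element of the completion that kills X but not e. -/
theorem IsInjectiveHull.mem_iff_torsionAnnihilator [IsNoetherianRing R] (hE : IsInjectiveHull ι)
    (hT : IsAdicTorsion (IsLocalRing.maximalIdeal R) E) (X : Submodule R E) (e : E) :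
    e ∈ X ↔ ∀ s ∈ torsionAnnihilator hT X, torsionSMul hT s e = 0 := by
  refine ⟨fun he s hs => hs e he, fun h => ?_⟩
  by_contra he
  obtain ⟨φ, hφ⟩ := hE.isCogenerator (E ⧸ X) (X.mkQ e) (by
    rwa [Submodule.mkQ_apply, ne_eq, Submodule.Quotient.mk_eq_zero])
  obtain ⟨s, hs⟩ := hE.exists_torsionSMul_eq hT (φ ∘ₗ X.mkQ)
  refine hφ ((hs e).trans (h s fun x hx => ?_))
  rw [← hs, LinearMap.comp_apply, Submodule.mkQ_apply, (Submodule.Quotient.mk_eq_zero X).mpr hx,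
    map_zero]

/-- A submodule of E is recovered from its annihilator in the completion, so descending chains in E
become ascending chains of ideals in a noetherian ring. -/
theorem IsInjectiveHull.isArtinian [IsNoetherianRing R] (hE : IsInjectiveHull ι) :
    IsArtinian R E := by
  have hT := hE.isAdicTorsion
  have hS := isNoetherianRing_adicCompletion (IsLocalRing.maximalIdeal R)
  rw [← monotone_stabilizes_iff_artinian]
  intro f
  obtain ⟨n, hn⟩ := monotone_stabilizes_iff_noetherian.mpr hS
    ⟨fun k => torsionAnnihilator hT (OrderDual.ofDual (f k)), fun a b hab s hs x hx =>
      hs x (f.monotone hab hx)⟩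
  refine ⟨n, fun k hk => ?_⟩
  have h : torsionAnnihilator hT (OrderDual.ofDual (f n)) =
    torsionAnnihilator hT (OrderDual.ofDual (f k)) := hn k hk
  refine OrderDual.ofDual.injective (Submodule.ext fun e => ?_)
  rw [hE.mem_iff_torsionAnnihilator hT, h, ← hE.mem_iff_torsionAnnihilator hT]

/-- The map from a free module of finite rank to the dual of `E ^ n`. -/
noncomputable def torsionDualPiMap (hT : IsAdicTorsion (IsLocalRing.maximalIdeal R) E) (n : ℕ) :
    (Fin n → Rhat) →ₗ[Rhat] TorsionDual (hT.pi n) E :=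
  Fintype.linearCombination Rhat fun i => TorsionDual.ofHom (hT.pi n) (LinearMap.proj i)

theorem torsionDualPiMap_apply (hT : IsAdicTorsion (IsLocalRing.maximalIdeal R) E) (n : ℕ)
    (c : Fin n → Rhat) (v : Fin n → E) :
    (torsionDualPiMap hT n c).hom v = ∑ i, torsionSMul hT (c i) (v i) := by
  rw [torsionDualPiMap, Fintype.linearCombination_apply, TorsionDual.sum_hom_apply]
  refine Finset.sum_congr rfl fun i _ => ?_
  exact map_torsionSMul (hT.pi n) hT (LinearMap.proj i) (c i) v

theorem IsInjectiveHull.torsionDualPiMap_bijective [IsNoetherianRing R] (hE : IsInjectiveHull ι)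
    (hT : IsAdicTorsion (IsLocalRing.maximalIdeal R) E) (n : ℕ) :
    Function.Bijective (torsionDualPiMap hT n) := by
  constructor
  · rw [injective_iff_map_eq_zero]
    refine fun c hc => funext fun i => hE.eq_zero_of_torsionSMul hT _ fun e => ?_
    have h := torsionDualPiMap_apply hT n c (Pi.single i e)
    rw [hc, Finset.sum_eq_single i (fun k _ hk => by
      rw [Pi.single_eq_of_ne hk, torsionSMul_zero_right]) (by simp), Pi.single_eq_same] at h
    exact h.symm
  · intro φ
    choose s hs using fun i => hE.exists_torsionSMul_eq hT
      (φ.hom ∘ₗ LinearMap.single R (fun _ => E) i)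
    refine ⟨s, TorsionDual.ext fun v => ?_⟩
    rw [torsionDualPiMap_apply]
    simp only [← hs, LinearMap.comp_apply, ← map_sum, LinearMap.coe_single]
    rw [Finset.univ_sum_single]

theorem IsInjectiveHull.projective_torsionDual_pi [IsNoetherianRing R] (hE : IsInjectiveHull ι)
    (hT : IsAdicTorsion (IsLocalRing.maximalIdeal R) E) (n : ℕ) :
    Module.Projective Rhat (TorsionDual (hT.pi n) E) :=
  Module.Projective.of_equiv (LinearEquiv.ofBijective _ (hE.torsionDualPiMap_bijective hT n))

/-- An embedding X → E^n dualizes to a surjection from a free module of rank n. -/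
theorem IsInjectiveHull.finite_torsionDual [IsNoetherianRing R] (hE : IsInjectiveHull ι)
    {X : Type u} [AddCommGroup X] [Module R X] [IsArtinian R X]
    (hX : IsAdicTorsion (IsLocalRing.maximalIdeal R) X) :
    Module.Finite Rhat (TorsionDual hX E) := by
  obtain ⟨n, j, hj⟩ := hE.isCogenerator.exists_injective_pi X
  have hT := hE.isAdicTorsion
  have : Module.Finite Rhat (TorsionDual (hT.pi n) E) :=
    Module.Finite.equiv (LinearEquiv.ofBijective _ (hE.torsionDualPiMap_bijective hT n))
  exact Module.Finite.of_surjective (torsionDualMap hX (hT.pi n) j)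
    (lcomp_surjective_of_injective hE.injective_module hj)

variable {A X : Type u} [AddCommGroup A] [Module R A] [AddCommGroup X] [Module R X]

/-- With `torsionDualMap_injective`, this makes duality fully faithful. For X = E^n the dual is free
on the coordinate projections, so Φ is given by n maps A → E. In general embed X in E^n and show
that the resulting A → E^n lands in X. -/
theorem IsInjectiveHull.torsionDualMap_surjective [IsNoetherianRing R] (hE : IsInjectiveHull ι)
    [IsArtinian R X] (hA : IsAdicTorsion (IsLocalRing.maximalIdeal R) A)
    (hX : IsAdicTorsion (IsLocalRing.maximalIdeal R) X) :
    Function.Surjective (torsionDualMap (E := E) hA hX) := by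
  intro Φ
  obtain ⟨n, j, hj⟩ := hE.isCogenerator.exists_injective_pi X
  have hT := hE.isAdicTorsion
  let p (i : Fin n) : TorsionDual (hT.pi n) E := TorsionDual.ofHom _ (LinearMap.proj i)
  let Ψ := Φ ∘ₗ torsionDualMap hX (hT.pi n) j
  let g : A →ₗ[R] Fin n → E := LinearMap.pi fun i => (Ψ (p i)).hom
  have hg : torsionDualMap hA (hT.pi n) g = Ψ := by
    refine LinearMap.ext fun φ => ?_
    obtain ⟨c, rfl⟩ := (hE.torsionDualPiMap_bijective hT n).2 φ
    refine TorsionDual.ext fun a => ?_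
    change (torsionDualPiMap hT n c).hom (g a) = _
    rw [torsionDualPiMap_apply, torsionDualPiMap, Fintype.linearCombination_apply, map_sum,
      TorsionDual.sum_hom_apply]
    refine Finset.sum_congr rfl fun i _ => ?_
    rw [map_smul, TorsionDual.smul_hom_apply, map_torsionSMul hA hT]
    rfl
  -- A functional on E^n that kills j(X) restricts to zero in the dual of X, so Ψ kills it; it
  -- therefore vanishes at g a.
  have hrange (a : A) : g a ∈ LinearMap.range j := by
    by_contra hne
    obtain ⟨φ, hφ⟩ := hE.isCogenerator _ ((LinearMap.range j).mkQ (g a)) (by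
      rwa [Submodule.mkQ_apply, ne_eq, Submodule.Quotient.mk_eq_zero])
    let θ : TorsionDual (hT.pi n) E :=
      TorsionDual.ofHom _ (φ ∘ₗ (LinearMap.range j).mkQ)
    have hθ : torsionDualMap hX (hT.pi n) j θ = 0 := TorsionDual.ext fun x => by
      change φ ((LinearMap.range j).mkQ (j x)) = 0
      rw [Submodule.mkQ_apply, (Submodule.Quotient.mk_eq_zero _).mpr (LinearMap.mem_range_self j x),
        map_zero]
    have h1 : torsionDualMap hA (hT.pi n) g θ = 0 := by
      rw [hg, LinearMap.comp_apply, hθ, map_zero]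
    exact hφ (congrArg (fun ψ : TorsionDual hA E => ψ.hom a) h1)
  refine ⟨(LinearEquiv.ofInjective j hj).symm.toLinearMap ∘ₗ g.codRestrict _ hrange,
    LinearMap.ext fun φ => ?_⟩
  obtain ⟨θ, rfl⟩ : ∃ θ, torsionDualMap hX (hT.pi n) j θ = φ :=
    lcomp_surjective_of_injective hE.injective_module hj φ
  refine (TorsionDual.ext fun a => ?_ : _ = torsionDualMap hA (hT.pi n) g θ).trans
    (LinearMap.congr_fun hg θ)
  change θ.hom (j ((LinearEquiv.ofInjective j hj).symm ⟨g a, hrange a⟩)) = θ.hom (g a)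
  exact congrArg θ.hom (congrArg Subtype.val
    ((LinearEquiv.ofInjective j hj).apply_symm_apply ⟨g a, hrange a⟩))

/-- `Ext^i` between artinian modules over `R` and `Ext^i` between their Matlis duals over the
completion vanish simultaneously. -/
theorem IsInjectiveHull.extVanishes_torsionDual_iff [IsNoetherianRing R]
    (hE : IsInjectiveHull ι) (hA : IsAdicTorsion (IsLocalRing.maximalIdeal R) A)
    [hXa : IsArtinian R X] (hX : IsAdicTorsion (IsLocalRing.maximalIdeal R) X) (i : ℕ) :
    ExtVanishes R A X i ↔ ExtVanishes Rhat (TorsionDual hX E) (TorsionDual hA E) i := by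
  induction i generalizing X with
  | zero =>
    rw [extVanishes_zero_iff, extVanishes_zero_iff]
    exact (Equiv.ofBijective _ ⟨torsionDualMap_injective hA hX hE.isCogenerator,
      hE.torsionDualMap_surjective hA hX⟩).subsingleton_congr
  | succ i ih =>
    obtain ⟨n, j, hj⟩ := hE.isCogenerator.exists_injective_pi X
    have hT := hE.isAdicTorsion
    have := hE.isArtinian
    have := hE.injective_module
    have hEn : Module.Injective R (Fin n → E) := inferInstance
    have := hE.projective_torsionDual_pi hT n
    let q := (LinearMap.range j).mkQ
    have hq : Function.Surjective q := (LinearMap.range j).mkQ_surjective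
    have hex : Function.Exact j q := LinearMap.exact_map_mkQ_range j
    -- E is artinian, so the cokernel of X → E^n is again artinian and the induction can continue
    -- with it.
    have hC : IsAdicTorsion (IsLocalRing.maximalIdeal R) ((Fin n → E) ⧸ LinearMap.range j) :=
      isAdicTorsion_of_isArtinian _
    let f' := torsionDualMap (E := E) (hT.pi n) hC q
    let g' := torsionDualMap (E := E) hX (hT.pi n) j
    have hf' : Function.Injective f' := lcomp_injective_of_surjective hq
    have hg' : Function.Surjective g' := lcomp_surjective_of_injective hE.injective_module hj
    have hex' : Function.Exact f' g' := lcomp_exact hq hex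
    cases i with
    | zero =>
      have hC' := hE.torsionDualMap_surjective hA hC
      have hCi := torsionDualMap_injective hA hC hE.isCogenerator
      have hF := hE.torsionDualMap_surjective hA (hT.pi n)
      rw [extVanishes_one_iff_of_injective hEn hj hq hex,
        extVanishes_one_iff_of_projective hf' hg' hex',
        ← Function.Surjective.of_comp_iff _ hF, ← Function.Surjective.of_comp_iff' ⟨hCi, hC'⟩]
      rfl
    | succ i =>
      rw [extVanishes_add_two_iff_of_injective hEn hj hq hex,
        extVanishes_add_two_iff_of_projective hf' hg' hex', ih hC]

end Matlis

/-! ### The three depth formulas -/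

theorem mainTheorem10 (R : Type u) [CommRing R] [IsLocalRing R] [IsNoetherianRing R]
    (E : Type u) [AddCommGroup E] [Module R E]
    (ι : IsLocalRing.ResidueField R →ₗ[R] E) (hE : IsInjectiveHull ι)
    (A A' N N' : Type u)
    [AddCommGroup A] [Module R A] [IsArtinian R A]
    [AddCommGroup A'] [Module R A'] [IsArtinian R A']
    [AddCommGroup N] [Module R N] [IsNoetherian R N]
    [AddCommGroup N'] [Module R N'] [IsNoetherian R N'] :
    (letI : Module (AdicCompletion (IsLocalRing.maximalIdeal R) R) A' :=
      torsionModule (isAdicTorsion_of_isArtinian A')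
    letI : Module (AdicCompletion (IsLocalRing.maximalIdeal R) R) (A →ₗ[R] E) :=
      torsionDualModule (isAdicTorsion_of_isArtinian A) E
    idealDepth (AdicCompletion (IsLocalRing.maximalIdeal R) R)
        (Module.annihilator (AdicCompletion (IsLocalRing.maximalIdeal R) R) A') (A →ₗ[R] E) =
      extInf R A A') ∧
    idealDepth R (Module.annihilator R N') (A →ₗ[R] E) = extInf R A (N' →ₗ[R] E) ∧
    idealDepth R (Module.annihilator R N') N = extInf R (N →ₗ[R] E) (N' →ₗ[R] E) := by
  refine ⟨?_, ?_, ?_⟩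
  · have hA : IsAdicTorsion (IsLocalRing.maximalIdeal R) A := isAdicTorsion_of_isArtinian A
    have hA' : IsAdicTorsion (IsLocalRing.maximalIdeal R) A' := isAdicTorsion_of_isArtinian A'
    have hS := isNoetherianRing_adicCompletion (IsLocalRing.maximalIdeal R)
    have hfin := hE.finite_torsionDual hA'
    have h := idealDepth_annihilator_eq_extInf
      (R := AdicCompletion (IsLocalRing.maximalIdeal R) R) (TorsionDual hA' E) (TorsionDual hA E)
    rw [annihilator_torsionDual hA' hE.isCogenerator] at h
    exact h.trans (extInf_congr fun i => (hE.extVanishes_torsionDual_iff hA hA' i).symm)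
  · rw [idealDepth_annihilator_eq_extInf]
    exact extInf_congr fun i => (extVanishes_dual_comm hE.injective_module A N' i).symm
  · rw [idealDepth_annihilator_eq_extInf]
    exact extInf_congr fun i =>
      (extVanishes_dual_dual_iff hE.injective_module hE.isCogenerator N' i).symm
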